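/- Work in the two-dimensional abstract Tile Assembly Model (aTAM). A glue is a pair of a finite string (over a fixed non-empty alphabet) and a strength in $\mathbb{N}$, with a single glue of strength $0$; a tile type is a 4-tuple of glues, one for each side of a unit square. Two adjacent tiles bind, with strength equal to the common strength of their abutting glues, if these glues are equal. An assembly is a non-empty, connected, possibly infinite partial arrangement of tiles on $\mathbb{Z}^2$, and it is $\tau$-stable if every cut of its weighted binding graph has weight at least $\tau$. A system $\mathcal{T}=(T,\sigma,\tau)$ consists of a finite set $T$ of tile types, a finite $\tau$-stable seed assembly $\sigma$ over $T$, and $\tau\in\mathbb{Z}^+$. An assembly is producible if it is the result of a finite or infinite sequence of $\tau$-stable assemblies over $T$ that starts with $\sigma$ and adds one tile at each step; it is terminal if it is $\tau$-stable and no further tile can be added $\tau$-stably. Each tile type has one color from a set of colors containing two distinct colors Black and White. The system weakly self-assembles a pattern $P$ on a set $D\subseteq\mathbb{Z}^2$ with colors from $\{\text{Black},\text{White}\}$ if in every producible terminal assembly the locations of the Black or White tiles are exactly the locations in $D$, and each of them has the color prescribed by $P$. For $n,i,j\in\mathbb{N}$ with $i,j<n$, let $\mathrm{Stripes}(n,i,j)$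 be the pattern on $\{0,\dots,n-1\}^2$ in which $(x,y)$ is Black if $x \bmod i=0$ or $y\bmod j=0$, and White otherwise (with the convention $x \bmod 0 = x$). Theorem. There is a function $f:\mathbb{N}\to\mathbb{R}$ with $f(n)=O(\log n)$ as $n\to\infty$ such that for all $n,i,j\in\mathbb{N}$ with $i,j<n$ there are an aTAM system $\mathcal{T}=(T,\sigma,2)$ (of temperature $2$) and a coloring of its tile types such that $|\sigma|=1$, $|T|\le f(n)$, and $\mathcal{T}$ weakly self-assembles $\mathrm{Stripes}(n,i,j)$. -/

import Mathlib

namespace ATAM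

/-- A glue over the alphabet `A`: a finite string label and a strength; the only glue of
strength `0` is the null glue, whose label is taken to be the empty string. -/
@[ext]
structure Glue (A : Type*) where
  label : List A
  strength : ℕ
  null_unique : strength = 0 → label = []

/-- The four sides of a unit square tile. -/
inductive Dir where
  | north
  | east
  | south
  | west

/-- The unit vector pointing out of a side. -/
def Dir.vec : Dir → ℤ × ℤ
  | north => (0, 1)
  | east => (1, 0)
  | south => (0, -1)
  | west => (-1, 0)

/-- The opposite side. -/
def Dir.opp : Dir → Dir
  | north => south
  | east => west
  | south => north
  | west => east

/-- A tile type is a 4-tuple of glues, one for each side. -/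
abbrev TileType (A : Type*) := Dir → Glue A

/-- A configuration: a partial arrangement of tiles on the lattice `ℤ²`. -/
abbrev Config (A : Type*) := ℤ × ℤ → Option (TileType A)

/-- The grid graph on `ℤ²`. -/
def gridGraph : SimpleGraph (ℤ × ℤ) where
  Adj p q := ∃ d : Dir, q = p + d.vec
  symm := ⟨by
    rintro p q ⟨d, rfl⟩
    refine ⟨d.opp, ?_⟩
    cases d <;> simp [Dir.vec, Dir.opp, add_assoc]⟩
  loopless := ⟨by
    rintro p ⟨d, h⟩
    cases d <;> simp [Dir.vec] at h⟩

namespace Config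

variable {A : Type*}

/-- The set of occupied locations (the shape of the configuration). -/
def dom (α : Config A) : Set (ℤ × ℤ) := {p | ∃ t, α p = some t}

open Classical in
/-- The weight of the edge of the binding graph that leaves location `p` through side `d`:
the common strength of the abutting glues if both locations are occupied and the two glues are
equal, and `0` (no edge) otherwise. -/
noncomputable def bond (α : Config A) (p : ℤ × ℤ) (d : Dir) : ℕ :=
  match α p, α (p + d.vec) with
  | some t, some u => if t d = u d.opp then (t d).strength else 0
  | _, _ => 0

/-- All tiles of the configuration belong to the tile set `T`. -/
def Over (α : Config A) (T : Finset (TileType A)) : Prop :=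
  ∀ p t, α p = some t → t ∈ T

/-- An assembly is a configuration whose domain is non-empty and connected in the grid. -/
def IsAssembly (α : Config A) : Prop :=
  (gridGraph.induce α.dom).Connected

/-- An assembly is `τ`-stable if every cut `(X, dom α \ X)` of its binding graph has weight at
least `τ`. An edge across the cut is given as a pair `(p, d)` with `p ∈ X` and `p + d.vec ∉ X`.
Since an assembly may be infinite, the weight of a cut may be infinite; it is at least `τ` iff
some finite set of crossing edges has total weight at least `τ`. -/
def Stable (τ : ℕ) (α : Config A) : Prop :=
  α.IsAssembly ∧
  ∀ X : Set (ℤ × ℤ), X ⊆ α.dom → X.Nonempty → X ≠ α.dom →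
    ∃ F : Finset ((ℤ × ℤ) × Dir),
      (∀ e ∈ F, e.1 ∈ X ∧ e.1 + e.2.vec ∈ α.dom \ X) ∧
      τ ≤ ∑ e ∈ F, α.bond e.1 e.2

/-- `α` is a subassembly of `β`. -/
def Sub (α β : Config A) : Prop :=
  ∀ p t, α p = some t → β p = some t

end Config

/-- A tile-assembly system: a finite tile set, a finite stable seed assembly over it, and a
positive temperature. -/
structure TAS (A : Type*) where
  tiles : Finset (TileType A)
  seed : Config A
  temp : ℕ
  temp_pos : 0 < temp
  seed_over : seed.Over tiles
  seed_finite : seed.dom.Finite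
  seed_stable : seed.Stable temp

namespace TAS

variable {A : Type*} (𝒯 : TAS A)

/-- `α` produces `β` in one step: both are stable assemblies over the tile set, and `β` is `α`
with exactly one tile added. -/
def Step (α β : Config A) : Prop :=
  α.Over 𝒯.tiles ∧ α.Stable 𝒯.temp ∧ β.Over 𝒯.tiles ∧ β.Stable 𝒯.temp ∧
  α.Sub β ∧ (β.dom \ α.dom).ncard = 1

/-- `α` produces `β`: there is an assembly sequence `s 0, s 1, …` with `k` terms, where `k` is a
positive integer or `∞`, that starts with `α` and whose result is `β`. The result consists of all
tiles of the assemblies of the sequence (for finite `k` it is the last assembly). -/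
def Produces (α β : Config A) : Prop :=
  ∃ (k : ℕ∞) (s : ℕ → Config A), 0 < k ∧ s 0 = α ∧
    (∀ i : ℕ, ((i + 1 : ℕ) : ℕ∞) < k → 𝒯.Step (s i) (s (i + 1))) ∧
    ∀ p t, β p = some t ↔ ∃ i : ℕ, (i : ℕ∞) < k ∧ s i p = some t

/-- `α` can be grown from the seed. -/
def Producible (α : Config A) : Prop := 𝒯.Produces 𝒯.seed α

/-- `α` is stable and no tile can be added to it. -/
def Terminal (α : Config A) : Prop :=
  α.Stable 𝒯.temp ∧ ¬ ∃ β, 𝒯.Step α β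

/-- With the tile types colored by `color`, the system weakly self-assembles the pattern `P`
(a set of locations with colors) with respect to the set `CP` of pattern colors: in every
producible terminal assembly, the locations of the tiles with a color in `CP` are exactly the
locations of `P`, and each of them has the color that `P` prescribes. -/
def WeaklySelfAssembles {C : Type*} (color : TileType A → C) (CP : Set C)
    (P : Set ((ℤ × ℤ) × C)) : Prop :=
  ∀ α : Config A, 𝒯.Producible α → 𝒯.Terminal α →
    {p | ∃ t, α p = some t ∧ color t ∈ CP} = Prod.fst '' P ∧
    ∀ l c, (l, c) ∈ P → ∃ t, α l = some t ∧ color t = c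

end TAS

/-- The stripes pattern on the square `[0, n-1]²`: the location `(x, y)` is black if
`x mod i = 0` or `y mod j = 0`, and white otherwise. -/
def stripes {C : Type*} (black white : C) (n i j : ℕ) : Set ((ℤ × ℤ) × C) :=
  {e | ∃ x y : ℕ, x < n ∧ y < n ∧ e.1 = ((x : ℤ), (y : ℤ)) ∧
    e.2 = if x % i = 0 ∨ y % j = 0 then black else white}

end ATAM

/-!
Let every glue have a direction of flow, and let the glues that flow into a tile have total strength
at most the temperature. Then a tile can only attach by its inputs, all of them, and if the inputs
offered at a location determine the tile, growth is forced: there is a single terminal assembly.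

A square is grown in this way with `O(log n)` tile types. The lowest `w = O(log n)` rows form a
band, in which a head zigzags through the columns, upwards in one column and downwards in the next.
It runs four counters with `w` bits. One of them counts the columns modulo `i`; one counts the rows
modulo `j`, namely for the column `x` the row `x + w` of the diagonal tile of this column; one stops
the head after column `n - 1`; and one stops the diagonal at the top of the square. The state of
the head and the symbols that it writes range over a fixed finite set, so a bounded number of tile
types for each row of the band suffices. Above the band a bounded number of tile types suffices
altogether: each column carries its color upwards, its diagonal tile learns the color of its own row
from the band, and each row carries its color from the diagonal to both sides.
-/

namespace ATAM

instance : DecidableEq Dir := fun a b => by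
  cases a <;> cases b <;> first | exact isTrue rfl | exact isFalse (by rintro ⟨⟩)

instance : Fintype Dir where
  elems := {.north, .east, .south, .west}
  complete := by rintro ⟨⟩ <;> simp

namespace Dir

lemma sum_univ (f : Dir → ℕ) : ∑ d, f d = f north + f east + f south + f west := by
  have huniv : (Finset.univ : Finset Dir) = {north, east, south, west} := rfl
  simp [huniv, add_assoc]

@[simp] lemma opp_opp (d : Dir) : d.opp.opp = d := by cases d <;> rfl

@[simp] lemma vec_opp (d : Dir) : d.opp.vec = -d.vec := by cases d <;> simp [opp, vec]

lemma opp_injective : Function.Injective opp :=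
  Function.LeftInverse.injective opp_opp

lemma vec_ne_zero (d : Dir) : d.vec ≠ 0 := by cases d <;> simp [vec]

end Dir

lemma eq_singleton_or_eq_or_inter_ne_of_subset_insert {ι : Type*} {a : ι} {s t : Set ι}
    (hne : s.Nonempty) (hs : s ⊆ insert a t) (hst : s ≠ insert a t) :
    s = {a} ∨ s = t ∨ (s ∩ t).Nonempty ∧ s ∩ t ≠ t := by
  by_cases hsa : s ⊆ {a}
  · exact .inl (hne.subset_singleton_iff.1 hsa)
  refine .inr (or_iff_not_imp_left.2 fun hne' => ⟨?_, fun h => ?_⟩)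
  · obtain ⟨b, hb, hba⟩ := Set.not_subset.1 hsa
    exact ⟨b, hb, (hs hb).resolve_left hba⟩
  · have hts : t ⊆ s := Set.inter_eq_right.1 h
    by_cases ha : a ∈ s
    · exact hst (hs.antisymm (Set.insert_subset ha hts))
    · exact hne' (((Set.subset_insert_iff_of_notMem ha).1 hs).antisymm hts)

lemma connected_induce_singleton {V : Type*} (G : SimpleGraph V) (v : V) :
    (G.induce {v}).Connected := by
  rw [SimpleGraph.induce_singleton_eq_top]
  exact SimpleGraph.connected_top

namespace Config

variable {A : Type*} {α β : Config A} {p : ℤ × ℤ} {t u : TileType A} {d : Dir} {τ : ℕ}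

section Bond

lemma mem_dom : p ∈ α.dom ↔ ∃ t, α p = some t := Iff.rfl

lemma bond_of_some (h : α p = some t) (h' : α (p + d.vec) = some u) [Decidable (t d = u d.opp)] :
    α.bond p d = if t d = u d.opp then (t d).strength else 0 := by
  simp only [bond, h, h']
  congr

lemma exists_of_bond_pos (h : 0 < α.bond p d) :
    ∃ t u, α p = some t ∧ α (p + d.vec) = some u ∧ t d = u d.opp ∧
      α.bond p d = (t d).strength := by
  classical
  cases h1 : α p with
  | none => simp [bond, h1] at h
  | some t =>
    cases h2 : α (p + d.vec) with
    | none => simp [bond, h1, h2] at h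
    | some u =>
      rw [bond_of_some h1 h2] at h ⊢
      split_ifs at h with h3
      · exact ⟨t, u, rfl, rfl, h3, if_pos h3⟩
      · exact absurd h (lt_irrefl 0)

lemma bond_opp (α : Config A) (p : ℤ × ℤ) (d : Dir) : α.bond (p + d.vec) d.opp = α.bond p d := by
  classical
  cases h1 : α p with
  | none => cases h2 : α (p + d.vec) <;> simp [bond, h1, h2]
  | some t =>
    cases h2 : α (p + d.vec) with
    | none => simp [bond, h1, h2]
    | some u =>
      rw [bond_of_some h1 h2, bond_of_some (t := u) (u := t) h2 (by simpa using h1)]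
      by_cases h : t d = u d.opp
      · simp [h]
      · rw [if_neg h, if_neg (by simpa using fun h' => h h'.symm)]

lemma dom_mono (h : α.Sub β) : α.dom ⊆ β.dom := fun _ ⟨t, ht⟩ => ⟨t, h _ t ht⟩

lemma Sub.bond_le (h : α.Sub β) (p : ℤ × ℤ) (d : Dir) : α.bond p d ≤ β.bond p d := by
  classical
  rcases Nat.eq_zero_or_pos (α.bond p d) with h0 | h0
  · simp [h0]
  · obtain ⟨t, u, h1, h2, h3, h4⟩ := exists_of_bond_pos h0
    rw [h4, bond_of_some (h _ _ h1) (h _ _ h2), if_pos h3]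

end Bond

section Bonded

variable {X X' Y Y' : Set (ℤ × ℤ)}

/-- The edges of the binding graph from `X` to `Y` have total weight at least `τ`, in the sense
in which `Stable` bounds the possibly infinite weight of a cut. -/
def Bonded (α : Config A) (τ : ℕ) (X Y : Set (ℤ × ℤ)) : Prop :=
  ∃ F : Finset ((ℤ × ℤ) × Dir),
    (∀ e ∈ F, e.1 ∈ X ∧ e.1 + e.2.vec ∈ Y) ∧ τ ≤ ∑ e ∈ F, α.bond e.1 e.2

lemma Bonded.symm (h : α.Bonded τ X Y) : α.Bonded τ Y X := by
  classical
  obtain ⟨F, hF, hτ⟩ := h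
  refine ⟨F.image fun e => (e.1 + e.2.vec, e.2.opp), ?_, ?_⟩
  · simp only [Finset.mem_image]
    rintro _ ⟨e, he, rfl⟩
    exact ⟨(hF e he).2, by simpa using (hF e he).1⟩
  · have hinj : Function.Injective fun e : (ℤ × ℤ) × Dir => (e.1 + e.2.vec, e.2.opp) := by
      rintro ⟨p, d⟩ ⟨q, d'⟩ h
      obtain ⟨h1, h2⟩ := Prod.ext_iff.1 h
      obtain rfl := Dir.opp_injective h2
      exact Prod.ext (add_right_cancel h1) rfl
    rw [Finset.sum_image hinj.injOn]
    simpa only [bond_opp] using hτ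

lemma Bonded.mono (h : α.Bonded τ X Y) (hsub : α.Sub β) (hX : X ⊆ X') (hY : Y ⊆ Y') :
    β.Bonded τ X' Y' := by
  obtain ⟨F, hF, hτ⟩ := h
  exact ⟨F, fun e he => ⟨hX (hF e he).1, hY (hF e he).2⟩,
    hτ.trans (Finset.sum_le_sum fun e _ => hsub.bond_le _ _)⟩

lemma bonded_singleton_iff :
    α.Bonded τ {p} (α.dom \ {p}) ↔ τ ≤ ∑ d, α.bond p d := by
  have hinj : Function.Injective (Prod.mk p : Dir → (ℤ × ℤ) × Dir) := Prod.mk_right_injective p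
  constructor
  · rintro ⟨F, hF, hτ⟩
    have hsub : F ⊆ Finset.univ.image (Prod.mk p) := by
      rintro ⟨q, d⟩ he
      simp [show q = p from (hF _ he).1]
    refine hτ.trans ((Finset.sum_le_sum_of_subset hsub).trans ?_)
    rw [Finset.sum_image hinj.injOn]
  · intro hτ
    refine ⟨(Finset.univ.filter fun d => 0 < α.bond p d).image (Prod.mk p), ?_, ?_⟩
    · simp only [Finset.mem_image, Finset.mem_filter, Finset.mem_univ, true_and]
      rintro _ ⟨d, hd, rfl⟩
      obtain ⟨-, u, -, hu, -⟩ := exists_of_bond_pos hd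
      exact ⟨rfl, ⟨u, hu⟩, by simpa using d.vec_ne_zero⟩
    · rw [Finset.sum_image hinj.injOn, Finset.sum_filter_of_ne fun d _ h => Nat.pos_of_ne_zero h]
      exact hτ

end Bonded

section Stable

lemma Stable.le_sum_bond (h : α.Stable τ) (hp : p ∈ α.dom) (hne : {p} ≠ α.dom) :
    τ ≤ ∑ d, α.bond p d :=
  bonded_singleton_iff.1 (h.2 {p} (Set.singleton_subset_iff.2 hp) (Set.singleton_nonempty p) hne)

/-- The configuration `α` with the tile `t` placed at `p`. -/
def addTile (α : Config A) (p : ℤ × ℤ) (t : TileType A) : Config A :=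
  Function.update α p (some t)

@[simp] lemma addTile_self : α.addTile p t p = some t := Function.update_self ..

lemma addTile_of_ne {q : ℤ × ℤ} (hq : q ≠ p) : α.addTile p t q = α q :=
  Function.update_of_ne hq ..

lemma dom_addTile : (α.addTile p t).dom = insert p α.dom := by
  ext q
  by_cases hq : q = p
  · simp [mem_dom, hq]
  · simp [mem_dom, addTile_of_ne, hq]

lemma dom_addTile_diff (hp : p ∉ α.dom) : (α.addTile p t).dom \ α.dom = {p} := by
  rw [dom_addTile, ← Set.union_singleton, Set.union_sdiff_left,
    (Set.disjoint_singleton_left.2 hp).sdiff_eq_left]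

lemma sub_addTile (hp : p ∉ α.dom) : α.Sub (α.addTile p t) := by
  intro q u hu
  have hq : q ≠ p := by
    rintro rfl
    exact hp ⟨u, hu⟩
  rw [addTile_of_ne hq, hu]

lemma IsAssembly.addTile (hα : α.IsAssembly) (hd : p + d.vec ∈ α.dom) :
    (α.addTile p t).IsAssembly := by
  unfold IsAssembly
  rw [dom_addTile, Set.insert_eq]
  exact SimpleGraph.connected_induce_union (connected_induce_singleton _ p).preconnected
    hα.preconnected rfl hd ⟨d, rfl⟩

lemma Stable.addTile (hα : α.Stable τ) (hτ0 : 0 < τ) (hp : p ∉ α.dom)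
    (hτ : τ ≤ ∑ d, (α.addTile p t).bond p d) :
    (α.addTile p t).Stable τ := by
  set β : Config A := α.addTile p t
  have hdom : β.dom = insert p α.dom := dom_addTile
  have hsub : α.Sub β := sub_addTile hp
  have hdiff : β.dom \ {p} = α.dom := by rw [hdom, Set.insert_sdiff_self_of_notMem hp]
  have hbond : β.Bonded τ {p} α.dom := hdiff ▸ bonded_singleton_iff.2 hτ
  constructor
  · obtain ⟨d, -, hd⟩ := Finset.exists_ne_zero_of_sum_ne_zero (hτ0.trans_le hτ).ne'
    obtain ⟨-, u, -, hu, -⟩ := exists_of_bond_pos (Nat.pos_of_ne_zero hd)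
    have hdα : p + d.vec ∈ α.dom := hdiff ▸ ⟨⟨u, hu⟩, by simpa using d.vec_ne_zero⟩
    exact hα.1.addTile hdα
  · intro X hX hne hXne
    change β.Bonded τ X (β.dom \ X)
    rcases eq_singleton_or_eq_or_inter_ne_of_subset_insert hne (hdom ▸ hX) (hdom ▸ hXne) with
      rfl | rfl | ⟨hne', hXne'⟩
    · rwa [hdiff]
    · rw [dom_addTile_diff hp]
      exact hbond.symm
    · refine Bonded.mono (hα.2 _ Set.inter_subset_right hne' hXne') hsub
        Set.inter_subset_left ?_
      rintro q ⟨hq, hqX⟩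
      exact ⟨dom_mono hsub hq, fun h => hqX ⟨h, hq⟩⟩

/-- The configuration with a single tile. -/
def single (p : ℤ × ℤ) (t : TileType A) : Config A :=
  addTile (fun _ => none) p t

lemma single_eq_some {q : ℤ × ℤ} : single p t q = some u ↔ q = p ∧ t = u := by
  by_cases hq : q = p
  · simp [single, hq]
  · simp [single, addTile_of_ne, hq]

@[simp] lemma dom_single : (single p t).dom = {p} := by
  ext q
  simp [mem_dom, single_eq_some]

lemma stable_single : (single p t).Stable τ := by
  refine ⟨?_, fun X hX hne hX2 => ?_⟩
  · unfold IsAssembly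
    rw [dom_single]
    exact connected_induce_singleton _ p
  · rw [dom_single] at hX hX2
    exact absurd (hne.subset_singleton_iff.1 hX) hX2

end Stable

end Config

namespace TAS

variable {A : Type*} {𝒯 : TAS A} {α β : Config A}

lemma step_iff (hα : α.dom.Nonempty) : 𝒯.Step α β ↔
    α.Over 𝒯.tiles ∧ α.Stable 𝒯.temp ∧ ∃ p t, p ∉ α.dom ∧ t ∈ 𝒯.tiles ∧
      β = α.addTile p t ∧ 𝒯.temp ≤ ∑ d, β.bond p d := by
  constructor
  · rintro ⟨hover, hstab, hover', hstab', hsub, hcard⟩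
    obtain ⟨p, hp⟩ := Set.ncard_eq_one.1 hcard
    obtain ⟨⟨t, ht⟩, hpα⟩ : p ∈ β.dom \ α.dom := hp.ge rfl
    refine ⟨hover, hstab, p, t, hpα, hover' p t ht, ?_, hstab'.le_sum_bond ⟨t, ht⟩ ?_⟩
    · funext q
      by_cases hqp : q = p
      · rw [hqp, Config.addTile_self, ht]
      rw [Config.addTile_of_ne hqp]
      by_cases hqα : q ∈ α.dom
      · obtain ⟨u, hu⟩ := hqα
        rw [hu, hsub q u hu]
      · have hqβ : q ∉ β.dom := fun h => hqp (hp.le ⟨h, hqα⟩)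
        rw [Option.eq_none_iff_forall_ne_some.2 fun u hu => hqα ⟨u, hu⟩,
          Option.eq_none_iff_forall_ne_some.2 fun u hu => hqβ ⟨u, hu⟩]
    · rintro hpβ
      obtain ⟨q, hq⟩ := hα
      exact hpα ((hpβ.ge (Config.dom_mono hsub hq) : q = p) ▸ hq)
  · rintro ⟨hover, hstab, p, t, hp, ht, rfl, hτ⟩
    refine ⟨hover, hstab, fun q u hq => ?_, hstab.addTile 𝒯.temp_pos hp hτ,
      Config.sub_addTile hp, ?_⟩
    · by_cases hqp : q = p
      · rw [hqp, Config.addTile_self, Option.some_inj] at hq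
        exact hq ▸ ht
      · exact hover q u (by rwa [Config.addTile_of_ne hqp] at hq)
    · rw [Config.dom_addTile_diff hp, Set.ncard_singleton]

end TAS

/-- A description of the tile types of a system and of the arrangement that it is to grow. The
tile types have names in `N` and nonzero glues in `G`. Every glue has a direction of flow: a side
of a tile is an input side if its glue flows into the tile, and an output side otherwise. -/
structure Blueprint (G N : Type*) where
  flow : G → Dir
  strength : G → ℕ
  strength_pos : ∀ g, 0 < strength g
  side : N → Dir → Option G
  layout : ℤ × ℤ → Option N
  origin : ℤ × ℤ

namespace Blueprint

variable {G N A C : Type*} (B : Blueprint G N)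

/-- The glue on the side `d` of the tile `t`, if this is an input side. -/
def input (t : N) (d : Dir) : Option G := (B.side t d).filter (B.flow · = d.opp)

/-- The total strength of the input sides of a tile. -/
def inputStrength (t : N) : ℕ := ∑ d, (B.input t d).elim 0 B.strength

/-- The layout contains neighbours that offer all the inputs of the tile `t` at `p`. -/
def InputsMatch (t : N) (p : ℤ × ℤ) : Prop :=
  ∀ d g, B.input t d = some g → ∃ u, B.layout (p + d.vec) = some u ∧ B.side u d.opp = some g

variable {B} {t : N} {d : Dir} {g : G} {τ : ℕ}

lemma input_eq_some : B.input t d = some g ↔ B.side t d = some g ∧ B.flow g = d.opp := by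
  simp [input, Option.filter_eq_some_iff]

variable (B τ) in
/-- The conditions under which a blueprint works at temperature `τ`: the tiles bind by exactly
their inputs, the inputs at a location determine the tile, and the layout can be grown from its
origin in the order of increasing rank. -/
structure Valid : Prop where
  flow_axis : ∀ t d g, B.side t d = some g → B.flow g = d ∨ B.flow g = d.opp
  inputStrength_le : ∀ t, B.inputStrength t ≤ τ
  unique : ∀ t p, B.inputStrength t = τ → B.InputsMatch t p → B.layout p = some t
  layout_match : ∀ p t, B.layout p = some t → B.InputsMatch t p
  layout_rank : ∃ rank : ℤ × ℤ → ℕ, ∀ p t d g, B.layout p = some t → B.input t d = some g →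
    rank (p + d.vec) < rank p
  layout_strength : ∀ p t, B.layout p = some t → p ≠ B.origin → B.inputStrength t = τ
  layout_origin : ∃ t, B.layout B.origin = some t ∧ B.inputStrength t = 0

lemma input_eq_none_of_inputStrength_eq_zero (h : B.inputStrength t = 0) (d : Dir) :
    B.input t d = none := by
  by_contra hd
  obtain ⟨g, hg⟩ := Option.ne_none_iff_exists'.1 hd
  have h0 := Finset.sum_eq_zero_iff.1 h d (Finset.mem_univ d)
  rw [hg] at h0
  exact (B.strength_pos g).ne' h0

section System

variable (B) (label : G ↪ List A)

/-- The glue with a given name. -/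
def toGlue : Option G → Glue A
  | none => ⟨[], 0, fun _ => rfl⟩
  | some g => ⟨label g, B.strength g, fun h => absurd h (B.strength_pos g).ne'⟩

lemma toGlue_injective : Function.Injective (B.toGlue label) := by
  rintro (_ | g) (_ | g') h
  · rfl
  · exact absurd (congrArg Glue.strength h) (B.strength_pos g').ne
  · exact absurd (congrArg Glue.strength h) (B.strength_pos g).ne'
  · exact congrArg some (label.injective (congrArg Glue.label h))

/-- The tile type with a given name. -/
def tile (t : N) : TileType A := fun d => B.toGlue label (B.side t d)

/-- The configuration that the blueprint describes. -/
def target : Config A := fun p => (B.layout p).map (B.tile label)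

lemma target_eq_some {p : ℤ × ℤ} {T : TileType A} :
    B.target label p = some T ↔ ∃ t, B.layout p = some t ∧ B.tile label t = T :=
  Option.map_eq_some_iff

open Classical in
/-- The tile system of a blueprint: it starts with the tile at the origin of the layout. -/
noncomputable def system [Fintype N] (hτ : 0 < τ) (hB : B.Valid τ) : TAS A where
  tiles := Finset.univ.image (B.tile label)
  seed := Config.single B.origin (B.tile label hB.layout_origin.choose)
  temp := τ
  temp_pos := hτ
  seed_over := by
    intro p T h
    rw [Config.single_eq_some] at h
    exact h.2 ▸ Finset.mem_image_of_mem _ (Finset.mem_univ _)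
  seed_finite := by simp
  seed_stable := Config.stable_single

lemma tile_mem_system [Fintype N] (hτ : 0 < τ) (hB : B.Valid τ) (t : N) :
    B.tile label t ∈ (B.system label hτ hB).tiles := by
  classical
  exact Finset.mem_image_of_mem _ (Finset.mem_univ _)

end System

section Grown

variable {label : G ↪ List A} {α β : Config A} {p : ℤ × ℤ}

variable (B label) in
/-- A part of the target that contains the seed, and with every tile the tiles that provide its
inputs. -/
structure Grown (α : Config A) : Prop where
  origin_mem : B.origin ∈ α.dom
  sub : α.Sub (B.target label)
  input_mem : ∀ p ∈ α.dom, ∀ t d g, B.layout p = some t → B.input t d = some g →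
    p + d.vec ∈ α.dom

/-- The glue that makes the bond cannot flow out of the new tile, since the neighbour would then
have been attached before one of its inputs was present. -/
lemma Grown.exists_input_of_bond_pos (hB : B.Valid τ) (hα : B.Grown label α) (hp : p ∉ α.dom)
    (hpos : 0 < (α.addTile p (B.tile label t)).bond p d) :
    ∃ g u, B.input t d = some g ∧ B.layout (p + d.vec) = some u ∧ B.side u d.opp = some g ∧
      p + d.vec ∈ α.dom ∧ (α.addTile p (B.tile label t)).bond p d = B.strength g := by
  obtain ⟨T, U, hT, hU, hTU, hbond⟩ := Config.exists_of_bond_pos hpos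
  obtain rfl : B.tile label t = T := by simpa using hT
  rw [Config.addTile_of_ne (by simpa using d.vec_ne_zero)] at hU
  obtain ⟨u, hu, rfl⟩ := (B.target_eq_some label).1 (hα.sub _ _ hU)
  have hside : B.side t d = B.side u d.opp := B.toGlue_injective label hTU
  cases hg : B.side t d with
  | none => simp [hbond, tile, toGlue, hg] at hpos
  | some g =>
    refine ⟨g, u, input_eq_some.2 ⟨hg, (hB.flow_axis t d g hg).resolve_left fun hflow => hp ?_⟩,
      hu, hside ▸ hg, ⟨_, hU⟩, by simp [hbond, tile, toGlue, hg]⟩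
    have hinput : B.input u d.opp = some g := input_eq_some.2 ⟨hside ▸ hg, by simpa using hflow⟩
    simpa using hα.input_mem _ ⟨_, hU⟩ u d.opp g hu hinput

lemma Grown.forall_bond_eq (hB : B.Valid τ) (hα : B.Grown label α) (hp : p ∉ α.dom)
    (hτ : τ ≤ ∑ d, (α.addTile p (B.tile label t)).bond p d) :
    B.inputStrength t = τ ∧ ∀ d, (α.addTile p (B.tile label t)).bond p d =
      (B.input t d).elim 0 B.strength := by
  have hle : ∀ d ∈ Finset.univ, (α.addTile p (B.tile label t)).bond p d ≤
      (B.input t d).elim 0 B.strength := by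
    intro d _
    rcases Nat.eq_zero_or_pos ((α.addTile p (B.tile label t)).bond p d) with h0 | hpos
    · simp [h0]
    · obtain ⟨g, -, hg, -, -, -, hbond⟩ := hα.exists_input_of_bond_pos hB hp hpos
      simp [hbond, hg]
  have hsum := Finset.sum_le_sum hle
  have hτ' : B.inputStrength t = τ := (hB.inputStrength_le t).antisymm (hτ.trans hsum)
  exact ⟨hτ', fun d => (Finset.sum_eq_sum_iff_of_le hle).1 (hsum.antisymm (hτ'.le.trans hτ)) d
    (Finset.mem_univ d)⟩

lemma Grown.addTile (hB : B.Valid τ) (hα : B.Grown label α) (hp : p ∉ α.dom)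
    (hτ : τ ≤ ∑ d, (α.addTile p (B.tile label t)).bond p d) :
    B.Grown label (α.addTile p (B.tile label t)) := by
  obtain ⟨hstrength, hbond⟩ := hα.forall_bond_eq hB hp hτ
  have hinput : ∀ d g, B.input t d = some g →
      p + d.vec ∈ α.dom ∧ ∃ u, B.layout (p + d.vec) = some u ∧ B.side u d.opp = some g := by
    intro d g hg
    have hpos : 0 < (α.addTile p (B.tile label t)).bond p d := by
      simpa [hbond, hg] using B.strength_pos g
    obtain ⟨g', u, hg', hu, hside, hmem, -⟩ := hα.exists_input_of_bond_pos hB hp hpos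
    obtain rfl : g = g' := Option.some_injective _ (hg.symm.trans hg')
    exact ⟨hmem, u, hu, hside⟩
  have hlayout : B.layout p = some t := hB.unique t p hstrength fun d g hg => (hinput d g hg).2
  have hmono : α.dom ⊆ (α.addTile p (B.tile label t)).dom :=
    Config.dom_mono (Config.sub_addTile hp)
  refine ⟨hmono hα.origin_mem, fun q T hq => ?_, fun q hq u d g hu hg => hmono ?_⟩
  · by_cases hqp : q = p
    · rw [hqp, Config.addTile_self, Option.some_inj] at hq
      rw [hqp, target_eq_some]
      exact ⟨t, hlayout, hq⟩
    · rw [Config.addTile_of_ne hqp] at hq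
      exact hα.sub q T hq
  · rw [Config.dom_addTile] at hq
    rcases hq with rfl | hq
    · obtain rfl : t = u := Option.some_injective _ (hlayout.symm.trans hu)
      exact (hinput d g hg).1
    · exact hα.input_mem q hq u d g hu hg

lemma Grown.inputStrength_le_sum_bond (hα : B.Grown label α) (hp : p ∉ α.dom)
    (hmatch : B.InputsMatch t p) (hmem : ∀ d g, B.input t d = some g → p + d.vec ∈ α.dom) :
    B.inputStrength t ≤ ∑ d, (α.addTile p (B.tile label t)).bond p d := by
  classical
  refine Finset.sum_le_sum fun d _ => ?_
  cases hg : B.input t d with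
  | none => exact Nat.zero_le _
  | some g =>
    obtain ⟨u, hu, hside⟩ := hmatch d g hg
    obtain ⟨T, hT⟩ := hmem d g hg
    obtain ⟨u', hu', rfl⟩ := (B.target_eq_some label).1 (hα.sub _ _ hT)
    obtain rfl : u = u' := Option.some_injective _ (hu.symm.trans hu')
    have hside' : B.side t d = some g := (input_eq_some.1 hg).1
    rw [Config.bond_of_some Config.addTile_self (Config.sub_addTile hp _ _ hT), if_pos]
    · simp [tile, toGlue, hside']
    · simp [tile, hside, hside']

variable [Fintype N] {hτ : 0 < τ} {hB : B.Valid τ}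

lemma grown_seed : B.Grown label (B.system label hτ hB).seed where
  origin_mem := by simp [system]
  sub := by
    intro p T h
    simp only [system, Config.single_eq_some] at h
    rw [target_eq_some, h.1]
    exact ⟨_, hB.layout_origin.choose_spec.1, h.2⟩
  input_mem := by
    intro p hp t d g ht hg
    simp only [system, Config.dom_single, Set.mem_singleton_iff] at hp
    obtain ⟨u, hu, hu0⟩ := hB.layout_origin
    obtain rfl : u = t := Option.some_injective _ (hu.symm.trans (hp ▸ ht))
    simp [input_eq_none_of_inputStrength_eq_zero hu0] at hg

lemma Grown.step (hα : B.Grown label α) (h : (B.system label hτ hB).Step α β) :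
    B.Grown label β := by
  classical
  obtain ⟨-, -, p, T, hp, hT, rfl, hsum⟩ := (TAS.step_iff ⟨_, hα.origin_mem⟩).1 h
  obtain ⟨t, -, rfl⟩ := Finset.mem_image.1 hT
  exact hα.addTile hB hp hsum

lemma grown_of_producible (h : (B.system label hτ hB).Producible α) : B.Grown label α := by
  obtain ⟨k, s, hk, h0, hs, hα⟩ := h
  have hgrown : ∀ i : ℕ, (i : ℕ∞) < k → B.Grown label (s i) := by
    intro i
    induction i with
    | zero => exact fun _ => h0 ▸ grown_seed
    | succ i ih =>
      exact fun hi => (ih (lt_of_le_of_lt (by exact_mod_cast i.le_succ) hi)).step (hs i hi)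
  have hdom : ∀ i : ℕ, (i : ℕ∞) < k → (s i).dom ⊆ α.dom :=
    fun i hi q ⟨T, hT⟩ => ⟨T, (hα q T).2 ⟨i, hi, hT⟩⟩
  refine ⟨hdom 0 hk (hgrown 0 hk).origin_mem, fun p T hT => ?_, ?_⟩
  · obtain ⟨i, hi, h⟩ := (hα p T).1 hT
    exact (hgrown i hi).sub p T h
  · rintro p ⟨T, hT⟩ t d g ht hg
    obtain ⟨i, hi, h⟩ := (hα p T).1 hT
    exact hdom i hi ((hgrown i hi).input_mem p ⟨T, h⟩ t d g ht hg)

lemma Grown.eq_target (hα : B.Grown label α) (hterm : (B.system label hτ hB).Terminal α) :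
    α = B.target label := by
  obtain ⟨rank, hrank⟩ := hB.layout_rank
  have hmem : ∀ p t, B.layout p = some t → p ∈ α.dom := by
    intro p
    induction p using (measure rank).wf.induction with
    | _ p ih =>
      intro t ht
      by_contra hp
      have hmatch := hB.layout_match p t ht
      have hinputs : ∀ d g, B.input t d = some g → p + d.vec ∈ α.dom := fun d g hg =>
        have ⟨u, hu, _⟩ := hmatch d g hg
        ih _ (hrank p t d g ht hg) u hu
      have hstrength : B.inputStrength t = τ :=
        hB.layout_strength p t ht fun h => hp (h ▸ hα.origin_mem)
      have hover : α.Over (B.system label hτ hB).tiles := by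
        intro q T hT
        obtain ⟨u, -, rfl⟩ := (B.target_eq_some label).1 (hα.sub q T hT)
        exact B.tile_mem_system label hτ hB u
      exact hterm.2 ⟨_, (TAS.step_iff ⟨_, hα.origin_mem⟩).2 ⟨hover, hterm.1, p, B.tile label t, hp,
        B.tile_mem_system label hτ hB t, rfl,
        hstrength.ge.trans (hα.inputStrength_le_sum_bond hp hmatch hinputs)⟩⟩
  funext p
  cases hp : α p with
  | some T => exact (hα.sub p T hp).symm
  | none =>
    refine (Option.eq_none_iff_forall_ne_some.2 fun T hT => ?_).symm
    obtain ⟨t, ht, -⟩ := (B.target_eq_some label).1 hT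
    obtain ⟨T', hT'⟩ := hmem p t ht
    simp [hp] at hT'

end Grown

section Color

variable (label : G ↪ List A)

lemma Valid.eq_of_tile_eq (hτ : 0 < τ) (hB : B.Valid τ) {p q : ℤ × ℤ} {t u : N}
    (ht : B.layout p = some t) (hu : B.layout q = some u)
    (h : B.tile label t = B.tile label u) : t = u := by
  have hside : B.side t = B.side u := funext fun d => B.toGlue_injective label (congrFun h d)
  have hinput : B.input t = B.input u := by
    funext d
    simp only [input, hside]
  have hstrength : B.inputStrength t = B.inputStrength u := by simp only [inputStrength, hinput]
  obtain ⟨v, hv, hv0⟩ := hB.layout_origin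
  by_cases hp : p = B.origin
  · obtain rfl : t = v := Option.some_injective _ (ht.symm.trans (hp ▸ hv))
    by_cases hq : q = B.origin
    · exact Option.some_injective _ (hv.symm.trans (hq ▸ hu))
    · have := hB.layout_strength q u hu hq
      omega
  · have hmatch : B.InputsMatch u p := fun d g hg => by
      rw [← hinput] at hg
      exact hB.layout_match p t ht d g hg
    exact Option.some_injective _ (ht.symm.trans
      (hB.unique u p (hstrength ▸ hB.layout_strength p t ht hp) hmatch))

theorem Valid.exists_weaklySelfAssembles [Fintype N] [Countable G] [Nonempty A] (hτ : 0 < τ)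
    (hB : B.Valid τ) (color : N → C) (CP : Set C) :
    ∃ (𝒯 : TAS A) (col : TileType A → C),
      𝒯.temp = τ ∧ 𝒯.seed.dom.ncard = 1 ∧ 𝒯.tiles.card ≤ Fintype.card N ∧
      𝒯.WeaklySelfAssembles col CP
        {e | e.2 ∈ CP ∧ ∃ t, B.layout e.1 = some t ∧ color t = e.2} := by
  classical
  obtain ⟨enc, henc⟩ := exists_injective_nat G
  let a : A := Classical.arbitrary A
  let label : G ↪ List A := ⟨fun g => List.replicate (enc g) a, fun g g' h => henc (by
    simpa using congrArg List.length h)⟩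
  have : Nonempty N := ⟨hB.layout_origin.choose⟩
  let occ : Set N := {t | ∃ p, B.layout p = some t}
  have hinj : Set.InjOn (B.tile label) occ := fun t ⟨_, ht⟩ u ⟨_, hu⟩ h =>
    hB.eq_of_tile_eq label hτ ht hu h
  let col : TileType A → C := color ∘ Function.invFunOn (B.tile label) occ
  have hcol : ∀ {p t}, B.layout p = some t → col (B.tile label t) = color t := fun {p t} ht =>
    congrArg color (hinj.leftInvOn_invFunOn ⟨p, ht⟩)
  refine ⟨B.system label hτ hB, col, rfl, by simp [system], Finset.card_image_le, ?_⟩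
  intro α hprod hterm
  have hα : α = B.target label := (grown_of_producible hprod).eq_target hterm
  simp only [hα, target_eq_some]
  refine ⟨?_, ?_⟩
  · ext p
    constructor
    · rintro ⟨_, ⟨t, ht, rfl⟩, hCP⟩
      exact ⟨(p, color t), ⟨hcol ht ▸ hCP, t, ht, rfl⟩, rfl⟩
    · rintro ⟨⟨_, c⟩, ⟨hCP, t, ht, rfl⟩, rfl⟩
      exact ⟨_, ⟨t, ht, rfl⟩, (hcol ht).symm ▸ hCP⟩
  · rintro p c ⟨-, t, ht, hc⟩
    exact ⟨_, ⟨t, ht, rfl⟩, (hcol ht).trans hc⟩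

end Color

end Blueprint

section GridLayout

variable {N : Type*} {n : ℕ} {f : ℕ → ℕ → N}

/-- The arrangement of `f x y` at the locations `(x, y)` of the square of side `n`. -/
def gridLayout (n : ℕ) (f : ℕ → ℕ → N) (p : ℤ × ℤ) : Option N :=
  if 0 ≤ p.1 ∧ p.1 < n ∧ 0 ≤ p.2 ∧ p.2 < n then some (f p.1.toNat p.2.toNat) else none

lemma gridLayout_eq_some {p : ℤ × ℤ} {t : N} :
    gridLayout n f p = some t ↔
      ∃ x y : ℕ, x < n ∧ y < n ∧ p = ((x : ℤ), (y : ℤ)) ∧ f x y = t := by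
  unfold gridLayout
  constructor
  · intro h
    split_ifs at h with hp
    obtain ⟨h1, h2, h3, h4⟩ := hp
    refine ⟨p.1.toNat, p.2.toNat, by omega, by omega, ?_, Option.some_injective _ h⟩
    ext <;> simp [h1, h3]
  · rintro ⟨x, y, hx, hy, rfl, rfl⟩
    rw [if_pos ⟨by simp, by simpa using hx, by simp, by simpa using hy⟩]
    simp

lemma gridLayout_coe {x y : ℕ} (hx : x < n) (hy : y < n) :
    gridLayout n f ((x : ℤ), (y : ℤ)) = some (f x y) :=
  gridLayout_eq_some.2 ⟨x, y, hx, hy, rfl, rfl⟩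

end GridLayout

/-- What the tiles of a column above the band have to know: whether the column is black, whether
the row of its diagonal tile is black, and whether this row is the first one beyond the square. -/
structure ColumnData where
  black : Bool
  rowBlack : Bool
  top : Bool
deriving Fintype

/-- The glues of the square construction. -/
inductive SquareGlue (Q S : Type*)
  | seed (k : ℕ)
  | turn (up : Bool) (s : S) (q : Q)
  | row (k : ℕ) (up : Bool) (s : S)
  | scan (k : ℕ) (up : Bool) (q : Q)
  | col (diag : Bool) (f : ColumnData)
  | rowEast (adj b : Bool)
  | rowWest (b : Bool)
deriving Countable

/-- The tiles of the square construction. -/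
inductive SquareTile (w : ℕ) (Q S : Type*)
  | seed (k : Fin w)
  | band (up : Bool) (k : Fin w) (q : Q) (s : S)
  | left (f : ColumnData) (b : Bool)
  | diag (f : ColumnData)
  | right (adj : Bool) (f : ColumnData) (b : Bool)
deriving Fintype

lemma SquareTile.card (w : ℕ) (Q S : Type*) [Fintype Q] [Fintype S] :
    Fintype.card (SquareTile w Q S) = (1 + 2 * Fintype.card Q * Fintype.card S) * w + 56 := by
  rw [← Fintype.card_congr (proxy_equiv% (SquareTile w Q S))]
  have hdata : Fintype.card ColumnData = 8 := rfl
  simp only [Fintype.card_sum, Fintype.card_sigma, Fintype.card_fin, Fintype.card_bool, hdata,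
    Finset.sum_const, Finset.card_univ, smul_eq_mul]
  ring

/-- A machine whose head sweeps through the first `w` cells of the columns `1, …, n - 1` of a
square, upwards in the odd and downwards in the even columns. In a cell the head, in state `q`,
reads a symbol `s` of the column on the left, writes the symbol `out y q s` for the column on the
right and changes its state to `next y q s`. Column `x` of the square is black if `colBlack x`, and
row `y` is black if `rowBlack y`. The functions `symbol` and `state` describe the run of the
machine: in the cell `(x, y)` it reads `symbol x y` in state `state x y`. -/
structure Scan (Q S : Type*) where
  n : ℕ
  w : ℕ
  next : ℕ → Q → S → Q
  out : ℕ → Q → S → S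
  halt : Q → Bool
  data : Q → ColumnData
  colBlack : ℕ → Bool
  rowBlack : ℕ → Bool
  symbol : ℕ → ℕ → S
  state : ℕ → ℕ → Q

namespace Scan

variable {Q S : Type*} (M : Scan Q S)

/-- The cell in which the head enters a column. -/
def start (up : Bool) : ℕ := if up then 0 else M.w - 1

/-- What column `x` has to know above the band, when its diagonal tile is at height `x + w`. -/
def columnData (x : ℕ) : ColumnData := ⟨M.colBlack x, M.rowBlack (x + M.w), decide (x + M.w = M.n)⟩

/-- The conditions under which the functions `symbol` and `state` describe a run of the machine
that stops at the end of column `n - 1`, and in column `x` knows `colBlack x` and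
`rowBlack (x + w)`. -/
structure Run : Prop where
  w_pos : 0 < M.w
  w_le : M.w ≤ M.n
  data_state : ∀ {x y}, 0 < x → x < M.n → y < M.w → M.data (M.state x y) = M.columnData x
  halt_state : ∀ {x y}, 0 < x → x ≤ M.n → y < M.w → M.halt (M.state x y) = decide (x = M.n)
  out_eq : ∀ {x y}, 0 < x → x < M.n → y < M.w →
    M.out y (M.state x y) (M.symbol x y) = M.symbol (x + 1) y
  next_eq : ∀ {x y}, 0 < x → x < M.n → y < M.w → y ≠ M.start (!x.bodd) →
    M.next y (M.state x y) (M.symbol x y) = M.state x (if x.bodd then y + 1 else y - 1)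
  next_last : ∀ {x y}, 0 < x → x < M.n → y < M.w → y = M.start (!x.bodd) →
    M.next y (M.state x y) (M.symbol x y) = M.state (x + 1) (M.start (!x.bodd))

/-- The glue on top of a column above the band, if any. -/
def colGlue (diag : Bool) (f : ColumnData) : Option (SquareGlue Q S) :=
  if diag && f.top then none else some (.col diag f)

/-- The glue on the west edge of the cell `(x, y)`. -/
def westGlue (x y : ℕ) : Option (SquareGlue Q S) :=
  if y < M.w then
    if x = 0 then none
    else if y ≠ M.start x.bodd then some (.row y x.bodd (M.symbol x y))
    else if x = M.n then none
    else some (.turn x.bodd (M.symbol x y) (M.state x y))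
  else if x + M.w ≤ y then some (.rowWest (M.rowBlack y))
  else some (.rowEast (decide (x + M.w = y + 1)) (M.rowBlack y))

/-- The glue on the south edge of the cell `(x, y)`. -/
def southGlue (x y : ℕ) : Option (SquareGlue Q S) :=
  if y = 0 then none
  else if y < M.w then
    if x = 0 then some (.seed y)
    else some (.scan y x.bodd (M.state x (if x.bodd then y else y - 1)))
  else colGlue (decide (x + M.w = y)) (M.columnData x)

/-- The glues on the edges of the cell `(x, y)`. -/
def edge (x y : ℕ) : Dir → Option (SquareGlue Q S)
  | .north => M.southGlue x (y + 1)
  | .south => M.southGlue x y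
  | .east => M.westGlue (x + 1) y
  | .west => M.westGlue x y

/-- The tile in the cell `(x, y)`. -/
def tileAt (x y : ℕ) : SquareTile M.w Q S :=
  if h : y < M.w then
    if x = 0 then .seed ⟨y, h⟩ else .band x.bodd ⟨y, h⟩ (M.state x y) (M.symbol x y)
  else if x + M.w < y then .left (M.columnData x) (M.rowBlack y)
  else if x + M.w = y then .diag (M.columnData x)
  else .right (decide (x + M.w = y + 1)) (M.columnData x) (M.rowBlack y)

/-- The sides of the tiles. -/
def side : SquareTile M.w Q S → Dir → Option (SquareGlue Q S)
  | .seed k, .north => if k + 1 = M.w then colGlue true (M.columnData 0) else some (.seed (k + 1))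
  | .seed k, .east => M.westGlue 1 k
  | .seed k, .south => if (k : ℕ) = 0 then none else some (.seed k)
  | .seed _, .west => none
  | .band up k q s, .north =>
    if k + 1 = M.w then some (.col false (M.data q))
    else some (.scan (k + 1) up (if up then M.next k q s else q))
  | .band up k q s, .south =>
    if (k : ℕ) = 0 then none else some (.scan k up (if up then q else M.next k q s))
  | .band up k q s, .east =>
    if k ≠ M.start (!up) then some (.row k (!up) (M.out k q s))
    else if M.halt (M.next k q s) then none
    else some (.turn (!up) (M.out k q s) (M.next k q s))
  | .band up k q s, .west =>
    if k ≠ M.start up then some (.row k up s) else some (.turn up s q)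
  | .left f _, .north | .left f _, .south => some (.col false f)
  | .left _ b, .east | .left _ b, .west => some (.rowWest b)
  | .diag f, .north => some (.col false f)
  | .diag f, .south => some (.col true f)
  | .diag f, .east => some (.rowEast true f.rowBlack)
  | .diag f, .west => some (.rowWest f.rowBlack)
  | .right adj f _, .north => colGlue adj f
  | .right _ f _, .south => some (.col false f)
  | .right _ _ b, .east => some (.rowEast false b)
  | .right adj _ b, .west => some (.rowEast adj b)

/-- The direction in which the information of a glue travels. -/
def flow : SquareGlue Q S → Dir
  | .seed _ => .south
  | .turn _ _ _ | .row _ _ _ | .rowEast _ _ => .east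
  | .scan _ up _ => if up then .north else .south
  | .col _ _ => .north
  | .rowWest _ => .west

/-- The strength of a glue: `2` if it is to attach the next tile by itself. -/
def strength : SquareGlue Q S → ℕ
  | .seed _ | .turn _ _ _ | .col true _ => 2
  | .row _ _ _ | .scan _ _ _ | .rowEast _ _ | .col false _ | .rowWest _ => 1

/-- The blueprint of the square construction. A column of seed tiles starts the sweeps of the
machine through the band of the lowest `w` rows; the columns rise from the band, and the rows
start at the diagonal `y = x + w` in both directions. -/
def blueprint : Blueprint (SquareGlue Q S) (SquareTile M.w Q S) where
  flow := flow
  strength := strength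
  strength_pos := by rintro (_ | _ | _ | _ | ⟨_ | _, _⟩ | _ | _) <;> simp [strength]
  side := M.side
  layout := gridLayout M.n M.tileAt
  origin := (0, (M.w : ℤ) - 1)

variable {M} {x y : ℕ}

section Edges

lemma edge_opp {x' y' : ℕ} {d : Dir} (h : ((x', y') : ℤ × ℤ) = ((x : ℤ), (y : ℤ)) + d.vec) :
    M.edge x' y' d.opp = M.edge x y d := by
  cases d <;>
    simp only [Dir.vec, Prod.mk_add_mk, Prod.mk.injEq] at h
  · obtain ⟨rfl, rfl⟩ : x' = x ∧ y' = y + 1 := by omega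
    rfl
  · obtain ⟨rfl, rfl⟩ : x' = x + 1 ∧ y' = y := by omega
    rfl
  · obtain ⟨rfl, rfl⟩ : x' = x ∧ y = y' + 1 := by omega
    rfl
  · obtain ⟨rfl, rfl⟩ : x = x' + 1 ∧ y' = y := by omega
    rfl

lemma side_seed_eq_edge (hM : M.Run) (hy : y < M.w) :
    M.side (.seed ⟨y, hy⟩) = M.edge 0 y := by
  have := hM.w_pos
  funext d
  cases d
  · simp only [side, edge, southGlue]
    split_ifs with h1 h2
    all_goals first | omega | simp_all
  all_goals simp [side, edge, westGlue, southGlue, hy]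

@[simp] lemma colGlue_false (f : ColumnData) :
    colGlue (Q := Q) (S := S) false f = some (.col false f) := rfl

lemma side_band_north (hM : M.Run) (hx : 0 < x) (hxn : x < M.n) (hy : y < M.w) :
    M.side (.band x.bodd ⟨y, hy⟩ (M.state x y) (M.symbol x y)) .north = M.southGlue x (y + 1) := by
  by_cases hyw : y + 1 = M.w
  · simp [side, southGlue, hyw, hM.data_state hx hxn hy, hx.ne', hM.w_pos.ne']
  · have hlast : y + 1 < M.w := by omega
    cases hup : x.bodd
    · simp [side, southGlue, hyw, hlast, hx.ne', hup]
    · have hnext := hM.next_eq hx hxn hy (by simp [start, hup]; omega)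
      simp [side, southGlue, hyw, hlast, hx.ne', hup, hnext]

lemma side_band_south (hM : M.Run) (hx : 0 < x) (hxn : x < M.n) (hy : y < M.w) :
    M.side (.band x.bodd ⟨y, hy⟩ (M.state x y) (M.symbol x y)) .south = M.southGlue x y := by
  by_cases hy0 : y = 0
  · simp [side, southGlue, hy0]
  · cases hup : x.bodd
    · have hnext := hM.next_eq hx hxn hy (by simpa [start, hup] using hy0)
      simp [side, southGlue, hy, hy0, hx.ne', hup, hnext]
    · simp [side, southGlue, hy, hy0, hx.ne', hup]

lemma side_band_east (hM : M.Run) (hx : 0 < x) (hxn : x < M.n) (hy : y < M.w) :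
    M.side (.band x.bodd ⟨y, hy⟩ (M.state x y) (M.symbol x y)) .east = M.westGlue (x + 1) y := by
  have hout := hM.out_eq hx hxn hy
  by_cases hlast : y = M.start (!x.bodd)
  · have hnext := hM.next_last hx hxn hy hlast
    rw [← hlast] at hnext
    have hhalt := hM.halt_state x.succ_pos hxn hy
    simp [side, westGlue, hy, ← hlast, hnext, hout, hhalt]
  · simp [side, westGlue, hy, hlast, hout]

lemma side_band_eq_edge (hM : M.Run) (hx : 0 < x) (hxn : x < M.n) (hy : y < M.w) :
    M.side (.band x.bodd ⟨y, hy⟩ (M.state x y) (M.symbol x y)) = M.edge x y := by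
  funext d
  cases d
  · exact side_band_north hM hx hxn hy
  · exact side_band_east hM hx hxn hy
  · exact side_band_south hM hx hxn hy
  · by_cases hfirst : y = M.start x.bodd
    · simp [side, edge, westGlue, hy, hx.ne', hxn.ne, ← hfirst]
    · simp [side, edge, westGlue, hy, hx.ne', hfirst]

lemma side_tileAt (hM : M.Run) (hx : x < M.n) (hy : y < M.n) :
    M.side (M.tileAt x y) = M.edge x y := by
  have hw := hM.w_pos
  unfold tileAt
  split_ifs with hband hx0 hleft hdiag
  · rw [hx0, side_seed_eq_edge hM hband]
  · exact side_band_eq_edge hM (Nat.pos_of_ne_zero hx0) hx hband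
  · have h1 : ¬ y + 1 < M.w := by omega
    have h2 : x + M.w ≠ y + 1 := by omega
    have h3 : x + 1 + M.w ≤ y := by omega
    have h4 : y ≠ 0 := by omega
    funext d
    cases d <;> simp [side, edge, southGlue, westGlue, hband, h1, h2, h3, h4, hleft.ne, hleft.le]
  · have h1 : ¬ y + 1 < M.w := by omega
    have h4 : y ≠ 0 := by omega
    have h5 : x + 1 + M.w = y + 1 := by omega
    have h6 : M.columnData x = ⟨M.colBlack x, M.rowBlack y, false⟩ := by
      simp [columnData, hdiag, hy.ne]
    funext d
    cases d <;> simp [side, edge, southGlue, westGlue, colGlue, hband, h1, h4, h5, h6, hdiag]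
  · have h1 : ¬ y + 1 < M.w := by omega
    have h2 : x + 1 + M.w ≠ y + 1 := by omega
    have h3 : ¬ x + 1 + M.w ≤ y := by omega
    have h4 : y ≠ 0 := by omega
    have h5 : ¬ x + M.w ≤ y := by omega
    funext d
    cases d <;> simp [side, edge, southGlue, westGlue, hband, h1, h2, h3, h4, h5, hdiag]

lemma westGlue_eq_turn {up : Bool} {s : S} {q : Q} (h : M.westGlue x y = some (.turn up s q)) :
    y < M.w ∧ 0 < x ∧ x ≠ M.n ∧ y = M.start up ∧ up = x.bodd ∧ s = M.symbol x y ∧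
      q = M.state x y := by
  unfold westGlue at h
  split_ifs at h <;> cases h
  exact ⟨‹_›, Nat.pos_of_ne_zero ‹_›, ‹_›, not_not.1 ‹_›, rfl, rfl, rfl⟩

lemma westGlue_eq_row {k : ℕ} {up : Bool} {s : S} (h : M.westGlue x y = some (.row k up s)) :
    y < M.w ∧ 0 < x ∧ k = y ∧ up = x.bodd ∧ s = M.symbol x y := by
  unfold westGlue at h
  split_ifs at h <;> cases h
  exact ⟨‹_›, Nat.pos_of_ne_zero ‹_›, rfl, rfl, rfl⟩

lemma westGlue_eq_rowEast {adj b : Bool} (h : M.westGlue x y = some (.rowEast adj b)) :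
    M.w ≤ y ∧ y < x + M.w ∧ adj = decide (x + M.w = y + 1) ∧ b = M.rowBlack y := by
  unfold westGlue at h
  split_ifs at h <;> cases h
  exact ⟨not_lt.1 ‹_›, not_le.1 ‹_›, rfl, rfl⟩

lemma westGlue_eq_rowWest {b : Bool} (h : M.westGlue x y = some (.rowWest b)) :
    x + M.w ≤ y ∧ b = M.rowBlack y := by
  unfold westGlue at h
  split_ifs at h <;> cases h
  exact ⟨‹_›, rfl⟩

lemma southGlue_eq_seed {k : ℕ} (h : M.southGlue x y = some (.seed k)) :
    x = 0 ∧ k = y ∧ y < M.w := by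
  unfold southGlue colGlue at h
  split_ifs at h <;> cases h
  exact ⟨‹_›, rfl, ‹_›⟩

lemma southGlue_eq_scan {k : ℕ} {up : Bool} {q : Q} (h : M.southGlue x y = some (.scan k up q)) :
    0 < x ∧ y < M.w ∧ k = y ∧ up = x.bodd ∧ q = M.state x (if x.bodd then y else y - 1) := by
  unfold southGlue colGlue at h
  split_ifs at h <;> first | cases h; done | skip
  all_goals
    cases h
    refine ⟨Nat.pos_of_ne_zero ‹_›, ‹_›, rfl, rfl, ?_⟩
    simp [*]

lemma southGlue_eq_col {diag : Bool} {f : ColumnData} (h : M.southGlue x y = some (.col diag f)) :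
    M.w ≤ y ∧ diag = decide (x + M.w = y) ∧ f = M.columnData x ∧ (diag = true → y ≠ M.n) := by
  unfold southGlue colGlue at h
  split_ifs at h <;> cases h
  refine ⟨not_lt.1 ‹_›, rfl, rfl, fun hdiag hyn => ?_⟩
  simp_all [columnData]

lemma flow_of_westGlue {g : SquareGlue Q S} (h : M.westGlue x y = some g) :
    flow g = .east ∨ flow g = .west := by
  unfold westGlue at h
  split_ifs at h <;> cases h <;> simp [flow]

lemma flow_axis (t : SquareTile M.w Q S) (d : Dir) (g : SquareGlue Q S) (h : M.side t d = some g) :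
    flow g = d ∨ flow g = d.opp := by
  cases t with
  | seed k =>
    cases d with
    | east => exact flow_of_westGlue h
    | west => cases h
    | _ =>
      simp only [side, colGlue] at h
      split_ifs at h <;> cases h <;> simp [flow, Dir.opp]
  | band up k q s =>
    cases d <;> simp only [side] at h <;> split_ifs at h <;> cases h <;> simp_all [flow, Dir.opp]
  | right adj f b =>
    cases d with
    | north =>
      simp only [side, colGlue] at h
      split_ifs at h
      cases h
      exact .inl rfl
    | _ => cases h; simp [flow, Dir.opp]
  | _ => cases d <;> cases h <;> simp [flow, Dir.opp]

end Edges

section InputStrength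

lemma inputStrength_eq (t : SquareTile M.w Q S) : M.blueprint.inputStrength t =
    ((M.side t .north).filter (flow · = .south)).elim 0 strength +
    ((M.side t .east).filter (flow · = .west)).elim 0 strength +
    ((M.side t .south).filter (flow · = .north)).elim 0 strength +
    ((M.side t .west).filter (flow · = .east)).elim 0 strength := by
  simp only [Blueprint.inputStrength, Dir.sum_univ]
  rfl

lemma inputStrength_seed (k : Fin M.w) :
    M.blueprint.inputStrength (.seed k) = if k + 1 = M.w then 0 else 2 := by
  have heast : (M.westGlue 1 k).filter (flow · = .west) = none := by
    unfold westGlue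
    split_ifs <;> first | omega | simp [flow]
  simp only [inputStrength_eq, side, heast, colGlue]
  split_ifs <;> simp [Option.filter_some, flow, strength]

lemma inputStrength_band {up : Bool} {k : Fin M.w} {q : Q} {s : S} :
    M.blueprint.inputStrength (.band up k q s) = 2 := by
  have hk := k.isLt
  cases up <;> simp only [inputStrength_eq, side, start] <;> split_ifs <;>
    first | omega | simp_all [Option.filter_some, flow, strength]

lemma inputStrength_left {f : ColumnData} {b : Bool} :
    M.blueprint.inputStrength (.left f b) = 2 := by
  simp [inputStrength_eq, Option.filter_some, side, flow, strength]

lemma inputStrength_diag {f : ColumnData} : M.blueprint.inputStrength (.diag f) = 2 := by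
  simp [inputStrength_eq, Option.filter_some, side, flow, strength]

lemma inputStrength_right {adj : Bool} {f : ColumnData} {b : Bool} :
    M.blueprint.inputStrength (.right adj f b) = 2 := by
  simp only [inputStrength_eq, side, colGlue]
  split_ifs <;> simp [Option.filter_some, flow, strength]

end InputStrength

section Unique

variable {p : ℤ × ℤ} {t : SquareTile M.w Q S} {g : SquareGlue Q S}

lemma exists_edge_of_inputsMatch (hM : M.Run) (h : M.blueprint.InputsMatch t p) {d : Dir}
    (hside : M.side t d = some g) (hflow : flow g = d.opp) :
    ∃ x y : ℕ, x < M.n ∧ y < M.n ∧ p + d.vec = ((x : ℤ), (y : ℤ)) ∧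
      M.edge x y d.opp = some g := by
  obtain ⟨u, hu, hg⟩ := h d g (Blueprint.input_eq_some.2 ⟨hside, hflow⟩)
  obtain ⟨x, y, hx, hy, hp, rfl⟩ := gridLayout_eq_some.1 hu
  exact ⟨x, y, hx, hy, hp, side_tileAt hM hx hy ▸ hg⟩

lemma seed_unique (hM : M.Run) {k : Fin M.w} (hk : (k : ℕ) + 1 ≠ M.w)
    (h : M.blueprint.InputsMatch (.seed k) p) : M.blueprint.layout p = some (.seed k) := by
  obtain ⟨x, y, hx, hy, hp, hg⟩ := exists_edge_of_inputsMatch hM h (d := .north)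
    (g := .seed (k + 1)) (by simp [side, hk]) rfl
  obtain ⟨rfl, rfl, -⟩ := southGlue_eq_seed hg
  obtain ⟨p₁, p₂⟩ := p
  simp only [Dir.vec, Prod.mk_add_mk, Prod.mk.injEq] at hp
  exact gridLayout_eq_some.2 ⟨0, k, hx, by omega, Prod.ext (by omega) (by omega), by simp [tileAt]⟩

lemma band_start_unique (hM : M.Run) {up : Bool} {k : Fin M.w} {q : Q} {s : S}
    (hk : (k : ℕ) = M.start up) (h : M.blueprint.InputsMatch (.band up k q s) p) :
    M.blueprint.layout p = some (.band up k q s) := by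
  obtain ⟨x, y, hx, hy, hp, hg⟩ := exists_edge_of_inputsMatch hM h (d := .west)
    (g := .turn up s q) (by simp [side, hk]) rfl
  obtain ⟨hyw, -, hxn, hyk, rfl, rfl, rfl⟩ := westGlue_eq_turn hg
  obtain ⟨p₁, p₂⟩ := p
  simp only [Dir.vec, Prod.mk_add_mk, Prod.mk.injEq] at hp
  obtain rfl : k = ⟨y, hyw⟩ := Fin.ext (hk.trans hyk.symm)
  exact gridLayout_eq_some.2 ⟨x + 1, y, by omega, hy, Prod.ext (by omega) (by omega),
    by simp [tileAt, hyw]⟩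

lemma band_unique (hM : M.Run) {up : Bool} {k : Fin M.w} {q : Q} {s : S}
    (hk : (k : ℕ) ≠ M.start up) (h : M.blueprint.InputsMatch (.band up k q s) p) :
    M.blueprint.layout p = some (.band up k q s) := by
  obtain ⟨x, y, -, hy, hp, hg⟩ := exists_edge_of_inputsMatch hM h (d := .west)
    (g := .row k up s) (by simp [side, hk]) rfl
  obtain ⟨hyw, -, hyk, hup, rfl⟩ := westGlue_eq_row hg
  obtain rfl : k = ⟨y, hyw⟩ := Fin.ext hyk
  obtain ⟨p₁, p₂⟩ := p
  simp only [Dir.vec, Prod.mk_add_mk, Prod.mk.injEq] at hp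
  have hlayout : x + 1 < M.n → q = M.state (x + 1) y →
      M.blueprint.layout (p₁, p₂) = some (.band up ⟨y, hyw⟩ q (M.symbol (x + 1) y)) := by
    rintro hxn rfl
    exact gridLayout_eq_some.2 ⟨x + 1, y, hxn, hy, Prod.ext (by omega) (by omega),
      by simp [tileAt, hyw, hup]⟩
  cases up
  · have hyw' : y + 1 ≠ M.w := fun h => hk (by simp [start, ← h])
    obtain ⟨x', y', hx', hy', hp', hg'⟩ := exists_edge_of_inputsMatch hM h (d := .north)
      (g := .scan (y + 1) false q) (by simp [side, hyw']) rfl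
    obtain ⟨-, -, rfl, hup', hq⟩ := southGlue_eq_scan hg'
    simp only [Dir.vec, Prod.mk_add_mk, Prod.mk.injEq] at hp'
    obtain rfl : x' = x + 1 := by omega
    exact hlayout hx' (by rw [hq, ← hup']; rfl)
  · have hy0 : y ≠ 0 := hk
    obtain ⟨x', y', hx', -, hp', hg'⟩ := exists_edge_of_inputsMatch hM h (d := .south)
      (g := .scan y true q) (by simp [side, hy0]) rfl
    obtain ⟨-, -, rfl, hup', hq⟩ := southGlue_eq_scan hg'
    simp only [Dir.vec, Prod.mk_add_mk, Prod.mk.injEq] at hp'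
    obtain rfl : x' = x + 1 := by omega
    exact hlayout hx' (by rw [hq, ← hup']; rfl)

lemma left_unique (hM : M.Run) {f : ColumnData} {b : Bool}
    (h : M.blueprint.InputsMatch (.left f b) p) : M.blueprint.layout p = some (.left f b) := by
  obtain ⟨x, y, hx, -, hp, hg⟩ := exists_edge_of_inputsMatch hM h (d := .south) rfl rfl
  obtain ⟨x', y', hx', hy', hp', hg'⟩ := exists_edge_of_inputsMatch hM h (d := .east) rfl rfl
  obtain ⟨hyw, -, rfl, -⟩ := southGlue_eq_col hg
  obtain ⟨hyx, rfl⟩ := westGlue_eq_rowWest hg'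
  obtain ⟨p₁, p₂⟩ := p
  simp only [Dir.vec, Prod.mk_add_mk, Prod.mk.injEq] at hp hp'
  obtain ⟨rfl, rfl⟩ : x' = x + 1 ∧ y' = y + 1 := by omega
  have hyw' : ¬ y + 1 < M.w := by omega
  have hleft : x + M.w < y + 1 := by omega
  exact gridLayout_eq_some.2 ⟨x, y + 1, hx, hy', Prod.ext (by omega) (by omega),
    by simp [tileAt, hyw', hleft]⟩

lemma diag_unique (hM : M.Run) {f : ColumnData} (h : M.blueprint.InputsMatch (.diag f) p) :
    M.blueprint.layout p = some (.diag f) := by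
  obtain ⟨x, y, hx, hy, hp, hg⟩ := exists_edge_of_inputsMatch hM h (d := .south) rfl rfl
  obtain ⟨-, hdiag, rfl, hyn⟩ := southGlue_eq_col hg
  have hdiag' : x + M.w = y + 1 := of_decide_eq_true hdiag.symm
  have hyn' := hyn rfl
  obtain ⟨p₁, p₂⟩ := p
  simp only [Dir.vec, Prod.mk_add_mk, Prod.mk.injEq] at hp
  exact gridLayout_eq_some.2 ⟨x, y + 1, hx, by omega, Prod.ext (by omega) (by omega),
    by simp [tileAt, ← hdiag']⟩

lemma right_unique (hM : M.Run) {adj : Bool} {f : ColumnData} {b : Bool}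
    (h : M.blueprint.InputsMatch (.right adj f b) p) :
    M.blueprint.layout p = some (.right adj f b) := by
  obtain ⟨x, y, hx, -, hp, hg⟩ := exists_edge_of_inputsMatch hM h (d := .south) rfl rfl
  obtain ⟨x', y', -, hy', hp', hg'⟩ := exists_edge_of_inputsMatch hM h (d := .west) rfl rfl
  obtain ⟨-, -, rfl, -⟩ := southGlue_eq_col hg
  obtain ⟨hyw', hyx, rfl, rfl⟩ := westGlue_eq_rowEast hg'
  obtain ⟨p₁, p₂⟩ := p
  simp only [Dir.vec, Prod.mk_add_mk, Prod.mk.injEq] at hp hp'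
  obtain ⟨rfl, rfl⟩ : x = x' + 1 ∧ y' = y + 1 := by omega
  have hright : ¬ x' + 1 + M.w < y + 1 := by omega
  have hdiag : x' + 1 + M.w ≠ y + 1 := by omega
  exact gridLayout_eq_some.2 ⟨x' + 1, y + 1, hx, hy', Prod.ext (by omega) (by omega),
    by simp [tileAt, hyw'.not_gt, hright, hdiag]⟩

lemma layout_eq_of_inputsMatch (hM : M.Run) (ht : M.blueprint.inputStrength t = 2)
    (h : M.blueprint.InputsMatch t p) : M.blueprint.layout p = some t := by
  cases t with
  | seed k =>
    refine seed_unique hM (fun hk => ?_) h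
    simp [inputStrength_seed, hk] at ht
  | band up k q s =>
    by_cases hk : (k : ℕ) = M.start up
    · exact band_start_unique hM hk h
    · exact band_unique hM hk h
  | left f b => exact left_unique hM h
  | diag f => exact diag_unique hM h
  | right adj f b => exact right_unique hM h

end Unique

section Rank

variable (M) in
/-- A rank for the order of growth: the band grows first, column by column in the direction of the
head, and then the rows above it, from the diagonal outwards. -/
def rank (x y : ℕ) : ℕ :=
  if y < M.w then x * M.w + (if x.bodd then y else M.w - 1 - y)
  else M.n * M.w + 2 * y + ((x + M.w - y) + (y - (x + M.w)))

lemma rank_of_lt (hy : y < M.w) :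
    M.rank x y = x * M.w + (if x.bodd then y else M.w - 1 - y) := if_pos hy

lemma rank_of_le (hy : M.w ≤ y) :
    M.rank x y = M.n * M.w + 2 * y + ((x + M.w - y) + (y - (x + M.w))) := if_neg hy.not_gt

lemma rank_lt_mul (hy : y < M.w) {m : ℕ} (hm : x < m) : M.rank x y < m * M.w := by
  have := Nat.mul_le_mul_right M.w (Nat.succ_le_of_lt hm)
  rw [Nat.succ_mul] at this
  rw [rank_of_lt hy]
  split_ifs <;> omega

lemma southGlue_flow_south {g : SquareGlue Q S} (h : M.southGlue x y = some g)
    (hflow : flow g = .south) :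
    y < M.w ∧ x.bodd = false := by
  unfold southGlue colGlue at h
  split_ifs at h <;> cases h <;> simp_all [flow]

lemma southGlue_flow_north {g : SquareGlue Q S} (h : M.southGlue x y = some g)
    (hflow : flow g = .north) :
    0 < y ∧ (y < M.w → x.bodd = true) := by
  unfold southGlue colGlue at h
  split_ifs at h <;> cases h <;> simp_all [flow, Nat.pos_iff_ne_zero]

lemma westGlue_flow_east {g : SquareGlue Q S} (h : M.westGlue x y = some g)
    (hflow : flow g = .east) :
    0 < x ∧ y < x + M.w := by
  unfold westGlue at h
  split_ifs at h <;> cases h <;> simp only [flow, reduceCtorEq] at hflow <;> omega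

lemma westGlue_flow_west {g : SquareGlue Q S} (h : M.westGlue x y = some g)
    (hflow : flow g = .west) :
    x + M.w ≤ y := by
  unfold westGlue at h
  split_ifs at h <;> cases h <;> first | assumption | simp [flow] at hflow

lemma exists_rank_lt (hM : M.Run) {d : Dir} {g : SquareGlue Q S} (hx : x < M.n) (hy : y < M.n)
    (h : M.edge x y d = some g) (hflow : flow g = d.opp) :
    ∃ x' y', x' < M.n ∧ y' < M.n ∧ ((x', y') : ℤ × ℤ) = ((x : ℤ), (y : ℤ)) + d.vec ∧
      M.rank x' y' < M.rank x y := by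
  have hwn := hM.w_le
  cases d with
  | north =>
    obtain ⟨hyw, hup⟩ := southGlue_flow_south h hflow
    refine ⟨x, y + 1, hx, by omega, by simp [Dir.vec], ?_⟩
    rw [rank_of_lt hyw, rank_of_lt (by omega), hup, if_neg (by decide), if_neg (by decide)]
    omega
  | south =>
    obtain ⟨hy0, hup⟩ := southGlue_flow_north h hflow
    obtain ⟨y, rfl⟩ := Nat.exists_eq_add_one.2 hy0
    refine ⟨x, y, hx, by omega, by simp [Dir.vec], ?_⟩
    rcases lt_or_ge (y + 1) M.w with hyw | hyw
    · rw [rank_of_lt hyw, rank_of_lt (by omega), hup hyw, if_pos rfl, if_pos rfl]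
      omega
    · rw [rank_of_le hyw]
      rcases lt_or_ge y M.w with hyw' | hyw'
      · exact (rank_lt_mul hyw' hx).trans_le (by omega)
      · rw [rank_of_le hyw']
        omega
  | east =>
    have hxy := westGlue_flow_west h hflow
    refine ⟨x + 1, y, by omega, hy, by simp [Dir.vec], ?_⟩
    rw [rank_of_le (by omega), rank_of_le (by omega)]
    omega
  | west =>
    obtain ⟨hx0, hxy⟩ := westGlue_flow_east h hflow
    obtain ⟨x, rfl⟩ := Nat.exists_eq_add_one.2 hx0
    refine ⟨x, y, by omega, hy, by simp [Dir.vec], ?_⟩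
    rcases lt_or_ge y M.w with hyw | hyw
    · refine (rank_lt_mul hyw x.lt_succ_self).trans_le ?_
      rw [rank_of_lt hyw]
      exact Nat.le_add_right _ _
    · rw [rank_of_le hyw, rank_of_le hyw]
      omega

lemma exists_layout_of_input (hM : M.Run) {p : ℤ × ℤ} {t : SquareTile M.w Q S} {d : Dir}
    {g : SquareGlue Q S} (ht : M.blueprint.layout p = some t)
    (hg : M.blueprint.input t d = some g) :
    (∃ u, M.blueprint.layout (p + d.vec) = some u ∧ M.side u d.opp = some g) ∧
      M.rank (p + d.vec).1.toNat (p + d.vec).2.toNat < M.rank p.1.toNat p.2.toNat := by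
  obtain ⟨x, y, hx, hy, rfl, rfl⟩ := gridLayout_eq_some.1 ht
  obtain ⟨hside, hflow⟩ := Blueprint.input_eq_some.1 hg
  replace hside : M.edge x y d = some g := side_tileAt hM hx hy ▸ hside
  obtain ⟨x', y', hx', hy', hp, hlt⟩ := exists_rank_lt hM hx hy hside hflow
  rw [← edge_opp hp, ← side_tileAt hM hx' hy'] at hside
  rw [← hp]
  exact ⟨⟨_, gridLayout_coe hx' hy', hside⟩, hlt⟩

end Rank

lemma tileAt_eq_seed {k : Fin M.w} (h : M.tileAt x y = .seed k) : x = 0 ∧ y = k := by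
  unfold tileAt at h
  split_ifs at h
  cases h
  exact ⟨‹_›, rfl⟩

lemma blueprint_valid (hM : M.Run) : M.blueprint.Valid 2 where
  flow_axis := flow_axis
  inputStrength_le t := by
    cases t with
    | seed k =>
      rw [inputStrength_seed]
      split_ifs <;> decide
    | band => exact inputStrength_band.le
    | left => exact inputStrength_left.le
    | diag => exact inputStrength_diag.le
    | right => exact inputStrength_right.le
  unique t p := layout_eq_of_inputsMatch hM
  layout_match p t ht d g hg := (exists_layout_of_input hM ht hg).1
  layout_rank := ⟨fun p => M.rank p.1.toNat p.2.toNat,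
    fun p t d g ht hg => (exists_layout_of_input hM ht hg).2⟩
  layout_strength p t ht hp := by
    obtain ⟨x, y, hx, hy, rfl, htile⟩ := gridLayout_eq_some.1 ht
    cases t with
    | seed k =>
      obtain ⟨rfl, rfl⟩ := tileAt_eq_seed htile
      rw [inputStrength_seed, if_neg fun hk => hp ?_]
      simp [blueprint, ← hk]
    | band => exact inputStrength_band
    | left => exact inputStrength_left
    | diag => exact inputStrength_diag
    | right => exact inputStrength_right
  layout_origin := by
    have hw := hM.w_pos
    have hlast : M.w - 1 < M.w := Nat.sub_lt hw one_pos
    refine ⟨.seed ⟨M.w - 1, hlast⟩, gridLayout_eq_some.2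
      ⟨0, M.w - 1, hw.trans_le hM.w_le, hlast.trans_le hM.w_le, ?_, by simp [tileAt, hw]⟩, ?_⟩
    · simp [blueprint, Nat.cast_sub (Nat.succ_le_of_lt hw)]
    · rw [inputStrength_seed, if_pos (Nat.sub_add_cancel hw)]

section Color

/-- The colors of the tiles, black being `true`. -/
def isBlack : SquareTile M.w Q S → Bool
  | .seed k => M.colBlack 0 || M.rowBlack k
  | .band _ k q _ => (M.data q).black || M.rowBlack k
  | .left f b | .right _ f b => f.black || b
  | .diag f => f.black || f.rowBlack

lemma isBlack_tileAt (hM : M.Run) (hx : x < M.n) :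
    isBlack (M.tileAt x y) = (M.colBlack x || M.rowBlack y) := by
  unfold tileAt
  split_ifs with hband hx0 hleft hdiag
  · rw [hx0]
    rfl
  · rw [isBlack, hM.data_state (Nat.pos_of_ne_zero hx0) hx hband]
    rfl
  · rfl
  · rw [← hdiag]
    rfl
  · rfl

theorem exists_weaklySelfAssembles {A C : Type*} [Nonempty A] [Fintype Q] [Fintype S]
    (hM : M.Run) (black white : C) :
    ∃ (𝒯 : TAS A) (col : TileType A → C),
      𝒯.temp = 2 ∧ 𝒯.seed.dom.ncard = 1 ∧
      𝒯.tiles.card ≤ (1 + 2 * Fintype.card Q * Fintype.card S) * M.w + 56 ∧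
      𝒯.WeaklySelfAssembles col {black, white}
        {e | ∃ x y : ℕ, x < M.n ∧ y < M.n ∧ e.1 = ((x : ℤ), (y : ℤ)) ∧
          e.2 = if M.colBlack x ∨ M.rowBlack y then black else white} := by
  obtain ⟨𝒯, col, htemp, hseed, hcard, hwsa⟩ :=
    (blueprint_valid hM).exists_weaklySelfAssembles (A := A) two_pos
      (fun t => if isBlack t then black else white) {black, white}
  refine ⟨𝒯, col, htemp, hseed, SquareTile.card M.w Q S ▸ hcard, ?_⟩
  convert hwsa using 1
  ext ⟨p, c⟩
  constructor
  · rintro ⟨x, y, hx, hy, rfl, rfl⟩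
    refine ⟨by dsimp only; split_ifs <;> simp, _, gridLayout_coe hx hy, ?_⟩
    simp [isBlack_tileAt hM hx]
  · rintro ⟨-, t, ht, rfl⟩
    obtain ⟨x, y, hx, hy, rfl, rfl⟩ := gridLayout_eq_some.1 ht
    exact ⟨x, y, hx, hy, rfl, by simp [isBlack_tileAt hM hx]⟩

end Color

end Scan

/-- The state of a counter modulo `m` that is increased by `2` in an upward sweep and reduced
modulo `m` in the following downward sweep. The flags `eqM` and `eqSucc` tell whether the sum agrees
with `m` and with `m + 1`, in the cells visited so far in the upward sweep, and `eqPred` tells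
whether the reduced sum agrees with `m - 1` in the cells visited so far in the downward sweep. The
flag `zero` tells whether `m` divides the number that is counted in the current column. -/
inductive CounterState
  | up (carry : Fin 3) (eqM eqSucc zero : Bool)
  | down (eqM eqSucc eqPred zero : Bool)
deriving Fintype

namespace CounterState

/-- Whether the modulus divides the number that is counted in the current column. -/
def zero : CounterState → Bool
  | .up _ _ _ z | .down _ _ _ z => z

/-- The bit that a counter modulo `m` writes in the cell `y` when it reads the bit `b`. -/
def out (m y : ℕ) : CounterState → Bool → Bool
  | .up c _ _ _, b => decide ((b.toNat + c) % 2 = 1)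
  | .down eqM eqSucc _ _, b => if eqM then false else if eqSucc then (1 % m).testBit y else b

/-- The state of a counter modulo `m` with `w` bits after it has read the bit `b` in the cell
`y`. -/
def next (w m y : ℕ) : CounterState → Bool → CounterState
  | .up c eqM eqSucc z, b =>
    let o := out m y (.up c eqM eqSucc z) b
    let eqM' := eqM && (o == m.testBit y)
    let eqSucc' := eqSucc && (o == (m + 1).testBit y)
    if y + 1 = w then .down eqM' eqSucc' true (eqM' || (eqSucc' && decide (1 % m = 0)))
    else .up (Fin.ofNat 3 ((b.toNat + c) / 2)) eqM' eqSucc' z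
  | .down eqM eqSucc eqPred z, b =>
    let eqPred' := eqPred && (out m y (.down eqM eqSucc eqPred z) b == (m - 1).testBit y)
    if y = 0 then .up 2 true true eqPred' else .down eqM eqSucc eqPred' z

/-- The carry into the cell `y` in the addition `v + 2`. -/
def carryAt (v y : ℕ) : ℕ := (v + 2) / 2 ^ y - v / 2 ^ y

/-- The state in the cell `y` of an upward sweep over the digits of `v`. -/
def ofUp (m v y : ℕ) : CounterState :=
  .up (Fin.ofNat 3 (carryAt v y)) (decide ((v + 2) % 2 ^ y = m % 2 ^ y))
    (decide ((v + 2) % 2 ^ y = (m + 1) % 2 ^ y)) (decide ((v + 1) % m = 0))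

/-- The state in the cell `y` of a downward sweep over the digits of `v + 2`. -/
def ofDown (m v y : ℕ) : CounterState :=
  .down (decide (v + 2 = m)) (decide (v + 2 = m + 1))
    (decide ((v + 2) % m / 2 ^ (y + 1) = (m - 1) / 2 ^ (y + 1))) (decide ((v + 2) % m = 0))

section Digits

lemma mod_two_pow_succ_eq_iff (u v k : ℕ) :
    u % 2 ^ (k + 1) = v % 2 ^ (k + 1) ↔ u % 2 ^ k = v % 2 ^ k ∧ u.testBit k = v.testBit k := by
  rw [pow_succ, Nat.mod_mul, Nat.mod_mul, Nat.testBit_eq_decide_div_mod_eq,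
    Nat.testBit_eq_decide_div_mod_eq, decide_eq_decide]
  have h0 : 0 < 2 ^ k := by positivity
  have h1 := Nat.mod_lt u h0
  have h2 := Nat.mod_lt v h0
  rcases Nat.mod_two_eq_zero_or_one (u / 2 ^ k) with h | h <;>
    rcases Nat.mod_two_eq_zero_or_one (v / 2 ^ k) with h' | h' <;> rw [h, h'] <;> omega

lemma div_two_pow_eq_iff (u v k : ℕ) :
    u / 2 ^ k = v / 2 ^ k ↔
      u / 2 ^ (k + 1) = v / 2 ^ (k + 1) ∧ u.testBit k = v.testBit k := by
  rw [pow_succ, ← Nat.div_div_eq_div_mul, ← Nat.div_div_eq_div_mul,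
    Nat.testBit_eq_decide_div_mod_eq, Nat.testBit_eq_decide_div_mod_eq, decide_eq_decide]
  omega

lemma carryAt_succ (v y : ℕ) :
    carryAt v (y + 1) = ((v.testBit y).toNat + carryAt v y) / 2 := by
  have h : v / 2 ^ y ≤ (v + 2) / 2 ^ y := Nat.div_le_div_right (by omega)
  unfold carryAt
  rw [pow_succ, ← Nat.div_div_eq_div_mul, ← Nat.div_div_eq_div_mul, Nat.toNat_testBit]
  omega

lemma carryAt_lt (v y : ℕ) : carryAt v y < 3 := by
  induction y with
  | zero => simp [carryAt]
  | succ y ih =>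
    rw [carryAt_succ]
    have := Bool.toNat_le (v.testBit y)
    omega

lemma coe_ofNat_carryAt (v y : ℕ) : (Fin.ofNat 3 (carryAt v y) : ℕ) = carryAt v y :=
  Nat.mod_eq_of_lt (carryAt_lt v y)

lemma testBit_add_two (v y : ℕ) :
    (v + 2).testBit y = decide (((v.testBit y).toNat + carryAt v y) % 2 = 1) := by
  have h : v / 2 ^ y ≤ (v + 2) / 2 ^ y := Nat.div_le_div_right (by omega)
  rw [Nat.testBit_eq_decide_div_mod_eq, decide_eq_decide, Nat.toNat_testBit]
  unfold carryAt
  omega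

end Digits

section Sweeps

variable {w m v y : ℕ}

lemma add_two_mod (hv : v < m) : (v + 2) % m =
    if v + 2 = m then 0 else if v + 2 = m + 1 then 1 % m else v + 2 := by
  split_ifs with h1 h2
  · rw [h1, Nat.mod_self]
  · rw [h2, Nat.add_mod_left]
  · exact Nat.mod_eq_of_lt (by omega)

lemma out_ofUp : out m y (ofUp m v y) (v.testBit y) = (v + 2).testBit y := by
  rw [testBit_add_two, ofUp, out, coe_ofNat_carryAt]

lemma out_ofDown (hv : v < m) :
    out m y (ofDown m v y) ((v + 2).testBit y) = ((v + 2) % m).testBit y := by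
  rw [add_two_mod hv]
  simp only [out, ofDown, decide_eq_true_eq]
  split_ifs <;> simp

lemma next_ofUp (hy : y + 1 ≠ w) : next w m y (ofUp m v y) (v.testBit y) = ofUp m v (y + 1) := by
  have hout := out_ofUp (m := m) (v := v) (y := y)
  unfold ofUp at hout ⊢
  simp only [next, hout, if_neg hy, coe_ofNat_carryAt, carryAt_succ, mod_two_pow_succ_eq_iff,
    Bool.decide_and, Bool.beq_eq_decide_eq]

lemma next_ofUp_last (hv : v < m) (hm : m + 1 < 2 ^ w) (hy : y + 1 = w) :
    next w m y (ofUp m v y) (v.testBit y) = ofDown m v y := by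
  have heq : ∀ c ≤ m + 1, ((v + 2) % 2 ^ y = c % 2 ^ y ∧ (v + 2).testBit y = c.testBit y ↔
      v + 2 = c) := fun c hc => by
    rw [← mod_two_pow_succ_eq_iff, hy, Nat.mod_eq_of_lt (by omega), Nat.mod_eq_of_lt (by omega)]
  have hdiv : ∀ c < m, c / 2 ^ (y + 1) = 0 := fun c hc => Nat.div_eq_of_lt (by rw [hy]; omega)
  have hzero : ((v + 2) % m = 0) = (v + 2 = m ∨ v + 2 = m + 1 ∧ 1 % m = 0) := by
    rw [add_two_mod hv]
    split_ifs <;> simp [*]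
  have hout := out_ofUp (m := m) (v := v) (y := y)
  unfold ofUp at hout ⊢
  simp only [next, hout, if_pos hy, ofDown, Bool.beq_eq_decide_eq, ← Bool.decide_and,
    ← Bool.decide_or, heq m (by omega), heq (m + 1) le_rfl, hzero,
    hdiv _ (Nat.mod_lt (v + 2) (by omega)), hdiv (m - 1) (by omega), decide_true]

lemma next_ofDown (hv : v < m) :
    next w m (y + 1) (ofDown m v (y + 1)) ((v + 2).testBit (y + 1)) = ofDown m v y := by
  have hout := out_ofDown (y := y + 1) hv
  unfold ofDown at hout ⊢
  simp only [next, hout, Nat.succ_ne_zero, if_false, Bool.beq_eq_decide_eq, ← Bool.decide_and,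
    ← div_two_pow_eq_iff]

lemma ofUp_zero : ofUp m v 0 = .up 2 true true (decide ((v + 1) % m = 0)) := by
  simp [ofUp, carryAt, Nat.mod_one]

lemma next_ofDown_zero (hv : v < m) :
    next w m 0 (ofDown m v 0) ((v + 2).testBit 0) = ofUp m ((v + 2) % m) 0 := by
  have hm : 0 < m := by omega
  have hlt := Nat.mod_lt (v + 2) hm
  have hzero : ((v + 2) % m = m - 1) = (((v + 2) % m + 1) % m = 0) := by
    rw [eq_iff_iff]
    constructor
    · intro h
      rw [h, Nat.sub_add_cancel hm, Nat.mod_self]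
    · intro h
      have := Nat.le_of_dvd (Nat.succ_pos _) (Nat.dvd_of_mod_eq_zero h)
      omega
  have hout := out_ofDown (y := 0) hv
  unfold ofDown at hout ⊢
  simp only [next, hout, if_true, Bool.beq_eq_decide_eq, ← Bool.decide_and, ← div_two_pow_eq_iff,
    pow_zero, Nat.div_one, hzero, ofUp_zero]

end Sweeps

section Columns

variable {w m a x y : ℕ}

/-- The value, modulo `m`, at the beginning of the pair of sweeps that contains column `x`, of a
counter for `x + a`. -/
def base (m a x : ℕ) : ℕ := ((x - 1) / 2 * 2 + a) % m

/-- The bit in the cell `(x, y)`. -/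
def symbol (m a x y : ℕ) : Bool :=
  if x.bodd then (base m a x).testBit y else (base m a x + 2).testBit y

/-- The state in the cell `(x, y)`. -/
def state (m a x y : ℕ) : CounterState :=
  if x.bodd then ofUp m (base m a x) y else ofDown m (base m a x) y

lemma base_lt (hm : 0 < m) : base m a x < m := Nat.mod_lt _ hm

lemma base_succ_of_odd (hx : x.bodd = true) : base m a (x + 1) = base m a x := by
  have hmod := Nat.mod_two_of_bodd x
  rw [hx, Bool.toNat_true] at hmod
  rw [base, base, show (x + 1 - 1) / 2 = (x - 1) / 2 by omega]

lemma base_succ_of_even (hx0 : 0 < x) (hx : x.bodd = false) :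
    base m a (x + 1) = (base m a x + 2) % m := by
  have hmod := Nat.mod_two_of_bodd x
  rw [hx, Bool.toNat_false] at hmod
  rw [base, base, Nat.mod_add_mod, show (x + 1 - 1) / 2 * 2 + a = (x - 1) / 2 * 2 + a + 2 by omega]

lemma zero_state (hx0 : 0 < x) : (state m a x y).zero = decide ((x + a) % m = 0) := by
  have hmod := Nat.mod_two_of_bodd x
  unfold state
  split_ifs with hx
  · rw [hx, Bool.toNat_true] at hmod
    rw [ofUp, zero, base, Nat.mod_add_mod, show (x - 1) / 2 * 2 + a + 1 = x + a by omega]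
  · rw [Bool.eq_false_of_not_eq_true hx, Bool.toNat_false] at hmod
    rw [ofDown, zero, base, Nat.mod_add_mod, show (x - 1) / 2 * 2 + a + 2 = x + a by omega]

lemma out_state (hm : 0 < m) (hx0 : 0 < x) :
    out m y (state m a x y) (symbol m a x y) = symbol m a (x + 1) y := by
  cases hx : x.bodd
  · simp [state, symbol, hx, out_ofDown (base_lt hm), base_succ_of_even hx0 hx]
  · simp [state, symbol, hx, out_ofUp, base_succ_of_odd hx]

lemma next_state_of_odd (hx : x.bodd = true) (hy : y + 1 ≠ w) :
    next w m y (state m a x y) (symbol m a x y) = state m a x (y + 1) := by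
  simp [state, symbol, hx, next_ofUp hy]

lemma next_state_of_odd_last (hm : 0 < m) (hmw : m + 1 < 2 ^ w) (hx : x.bodd = true)
    (hy : y + 1 = w) : next w m y (state m a x y) (symbol m a x y) = state m a (x + 1) y := by
  simp [state, symbol, hx, next_ofUp_last (base_lt hm) hmw hy, base_succ_of_odd hx]

lemma next_state_of_even (hm : 0 < m) (hx : x.bodd = false) :
    next w m (y + 1) (state m a x (y + 1)) (symbol m a x (y + 1)) = state m a x y := by
  simp only [state, symbol, hx, Bool.false_eq_true, if_false, next_ofDown (base_lt hm)]

lemma next_state_of_even_zero (hm : 0 < m) (hx0 : 0 < x) (hx : x.bodd = false) :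
    next w m 0 (state m a x 0) (symbol m a x 0) = state m a (x + 1) 0 := by
  simp only [state, symbol, hx, Nat.bodd_succ, Bool.not_false, Bool.false_eq_true, if_false,
    if_true, next_ofDown_zero (base_lt hm), base_succ_of_even hx0 hx]

end Columns

end CounterState

section CounterScan

open CounterState

/-- The machine that runs four counters in parallel: for the columns of the stripes of period `i`,
for the rows of the stripes of period `j` on the diagonal, for the east end of the square, and for
the column in which the diagonal leaves the square. -/
def counterScan (n w i j : ℕ) : Scan (Fin 4 → CounterState) (Fin 4 → Bool) where
  n := n
  w := w
  next y q s c := next w (![i, j, n, n] c) y (q c) (s c)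
  out y q s c := out (![i, j, n, n] c) y (q c) (s c)
  halt q := (q 2).zero
  data q := ⟨(q 0).zero, (q 1).zero, (q 3).zero⟩
  colBlack x := decide (x % i = 0)
  rowBlack y := decide (y % j = 0)
  symbol x y c := symbol (![i, j, n, n] c) (![0, w, 0, w] c) x y
  state x y c := state (![i, j, n, n] c) (![0, w, 0, w] c) x y

lemma mod_eq_zero_iff_of_lt_two_mul {m n : ℕ} (hm : 0 < m) (hlt : m < 2 * n) :
    m % n = 0 ↔ m = n := by
  constructor
  · intro h
    obtain ⟨k, rfl⟩ := Nat.dvd_of_mod_eq_zero h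
    have hk : k = 1 := by
      have hk2 : k < 2 := Nat.lt_of_mul_lt_mul_left (by rwa [mul_comm 2] at hlt)
      have hk0 : 0 < k := Nat.pos_of_mul_pos_left hm
      omega
    rw [hk, mul_one]
  · rintro rfl
    exact Nat.mod_self _

lemma counterScan_run {n w i j : ℕ} (hw : 0 < w) (hwn : w ≤ n) (hnw : 1 < n → n + 1 < 2 ^ w)
    (hi : 0 < i) (hin : i ≤ n) (hj : 0 < j) (hjn : j ≤ n) : (counterScan n w i j).Run := by
  have hperiod : ∀ c, 0 < ![i, j, n, n] c ∧ ![i, j, n, n] c ≤ n := by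
    have hn := hw.trans_le hwn
    intro c
    fin_cases c <;> simp [*]
  exact {
    w_pos := hw
    w_le := hwn
    data_state := fun {x y} hx hxn _ => by
      change x < n at hxn
      have htop : (x + w) % n = 0 ↔ x + w = n :=
        mod_eq_zero_iff_of_lt_two_mul (Nat.add_pos_left hx w) (by omega)
      simp only [counterScan, Scan.columnData, zero_state hx, ColumnData.mk.injEq]
      exact ⟨rfl, rfl, decide_eq_decide.2 htop⟩
    halt_state := fun {x y} hx hxn _ => by
      change x ≤ n at hxn
      have hend : x % n = 0 ↔ x = n := mod_eq_zero_iff_of_lt_two_mul hx (by omega)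
      simp only [counterScan, zero_state hx]
      exact decide_eq_decide.2 hend
    out_eq := fun hx _ _ => funext fun c => out_state (hperiod c).1 hx
    next_eq := fun {x y} _ _ _ hstart => funext fun c => by
      cases hx : x.bodd
      · obtain ⟨y, rfl⟩ := Nat.exists_eq_succ_of_ne_zero (n := y)
          (by simpa [Scan.start, hx] using hstart)
        exact next_state_of_even (hperiod c).1 hx
      · have hy : y + 1 ≠ w := by
          rintro rfl
          exact hstart (by simp [Scan.start, hx, counterScan])
        exact next_state_of_odd hx hy
    next_last := fun {x y} hx0 hxn _ hstart => funext fun c => by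
      change x < n at hxn
      subst hstart
      cases hx : x.bodd
      · exact next_state_of_even_zero (hperiod c).1 hx0 hx
      · exact next_state_of_odd_last (hperiod c).1
          ((Nat.succ_le_succ (hperiod c).2).trans_lt (hnw (by omega))) hx (Nat.sub_add_cancel hw) }

end CounterScan

lemma succ_lt_two_pow_min_log {n : ℕ} (hn : 1 < n) : n + 1 < 2 ^ min n (Nat.log 2 n + 2) := by
  rcases min_choice n (Nat.log 2 n + 2) with h | h <;> rw [h]
  · obtain ⟨k, rfl⟩ := Nat.exists_eq_add_one.2 (zero_lt_one.trans hn)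
    have := k.lt_two_pow_self
    rw [pow_succ]
    omega
  · have := Nat.lt_pow_succ_log_self one_lt_two n
    rw [pow_succ]
    omega

lemma exists_period {n : ℕ} (hn : 0 < n) (i : ℕ) :
    ∃ m, 0 < m ∧ m ≤ n ∧ ∀ x < n, x % m = 0 ↔ x % i = 0 := by
  by_cases hi : 0 < i ∧ i ≤ n
  · exact ⟨i, hi.1, hi.2, fun _ _ => Iff.rfl⟩
  · refine ⟨n, hn, le_rfl, fun x hx => ?_⟩
    rw [Nat.mod_eq_of_lt hx]
    rcases Nat.eq_zero_or_pos i with rfl | hi0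
    · rw [Nat.mod_zero]
    · rw [Nat.mod_eq_of_lt (by omega)]

theorem exists_weaklySelfAssembles_stripes {A C : Type*} [Nonempty A] (black white : C) {n : ℕ}
    (hn : 0 < n) (i j : ℕ) :
    ∃ (𝒯 : TAS A) (color : TileType A → C),
      𝒯.temp = 2 ∧ 𝒯.seed.dom.ncard = 1 ∧
      𝒯.tiles.card ≤ (1 + 2 * Fintype.card (Fin 4 → CounterState) *
        Fintype.card (Fin 4 → Bool)) * (Nat.log 2 n + 2) + 56 ∧
      𝒯.WeaklySelfAssembles color {black, white} (stripes black white n i j) := by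
  obtain ⟨i', hi', hin, hi⟩ := exists_period hn i
  obtain ⟨j', hj', hjn, hj⟩ := exists_period hn j
  have hrun := counterScan_run (lt_min hn (Nat.succ_pos (Nat.log 2 n + 1))) (min_le_left n _)
    succ_lt_two_pow_min_log hi' hin hj' hjn
  obtain ⟨𝒯, color, htemp, hseed, hcard, hwsa⟩ :=
    Scan.exists_weaklySelfAssembles (A := A) hrun black white
  refine ⟨𝒯, color, htemp, hseed, hcard.trans ?_, ?_⟩
  · gcongr
    exact min_le_right _ _
  · convert hwsa using 1
    ext e
    refine exists_congr fun x => exists_congr fun y => and_congr_right fun hx =>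
      and_congr_right fun hy => ?_
    simp only [counterScan, decide_eq_true_eq, hi x hx, hj y hy]

lemma isBigO_natLog (a b c : ℝ) :
    (fun n : ℕ => a * (Nat.log 2 n + b) + c) =O[Filter.atTop] (fun n : ℕ => Real.log n) := by
  have hconst (c : ℝ) : (fun _ : ℕ => c) =O[Filter.atTop] (fun n : ℕ => Real.log n) :=
    (Real.isLittleO_const_log_atTop.comp_tendsto tendsto_natCast_atTop_atTop).isBigO
  have hlog : (fun n : ℕ => (Nat.log 2 n : ℝ)) =O[Filter.atTop] (fun n : ℕ => Real.log n) := by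
    refine Asymptotics.IsBigO.of_bound (Real.log 2)⁻¹ (.of_forall fun n => ?_)
    rw [Real.norm_natCast, Real.norm_of_nonneg (Real.log_natCast_nonneg n), inv_mul_eq_div]
    exact Real.natLog_le_logb n 2
  exact ((hlog.add (hconst b)).const_mul_left a).add (hconst c)

end ATAM

theorem theorem3_general :
    ∃ f : ℕ → ℝ, f =O[Filter.atTop] (fun n : ℕ => Real.log n) ∧
      ∀ (A : Type*) [Nonempty A] (C : Type*) (black white : C) (n i j : ℕ), 0 < n →
          ∃ (𝒯 : ATAM.TAS A) (color : ATAM.TileType A → C),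
            𝒯.temp = 2 ∧
            𝒯.seed.dom.ncard = 1 ∧
            (𝒯.tiles.card : ℝ) ≤ f n ∧
            𝒯.WeaklySelfAssembles color {black, white} (ATAM.stripes black white n i j) := by
  refine ⟨_, ATAM.isBigO_natLog (1 + 2 * Fintype.card (Fin 4 → ATAM.CounterState) *
    Fintype.card (Fin 4 → Bool)) 2 56, fun A _ C black white n i j hn => ?_⟩
  obtain ⟨𝒯, color, htemp, hseed, hcard, hwsa⟩ :=
    ATAM.exists_weaklySelfAssembles_stripes (A := A) black white hn i j
  exact ⟨𝒯, color, htemp, hseed, mod_cast hcard, hwsa⟩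

theorem theorem3 :
    ∃ f : ℕ → ℝ, f =O[Filter.atTop] (fun n : ℕ => Real.log n) ∧
      ∀ (A : Type*) [Nonempty A] (C : Type*) (black white : C), black ≠ white →
        ∀ n i j : ℕ, i < n → j < n →
          ∃ (𝒯 : ATAM.TAS A) (color : ATAM.TileType A → C),
            𝒯.temp = 2 ∧
            𝒯.seed.dom.ncard = 1 ∧
            (𝒯.tiles.card : ℝ) ≤ f n ∧
            𝒯.WeaklySelfAssembles color {black, white} (ATAM.stripes black white n i j) :=
  have ⟨f, hf, h⟩ := theorem3_general
  ⟨f, hf, fun A _ C black white _ n i j hi _ => h A C black white n i j (Nat.zero_lt_of_lt hi)⟩
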